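/- Let $X$ be a locally compact, separable, metrizable space, $m$ a positive Radon measure on $X$ with full support, and $(\mathcal E,\mathcal F)$ a regular Dirichlet form on $L^2(X;m)$ that is strong local: $\mathcal E(f,g)=0$ for all $f,g\in\mathcal F$ such that $\operatorname{supp}[f]$ and $\operatorname{supp}[g]$ are compact and $g$ is constant on a neighbourhood of $\operatorname{supp}[f]$, where $\operatorname{supp}[f]$ is the support of the measure $|f|\cdot m$. Equip $\mathcal F$ with the inner product $\mathcal E(f,g)+\int_X fg\,dm$. For bounded $f\in\mathcal F$, the energy measure $\mu_{\langle f\rangle}$ is the Radon measure on $X$ with $$\int_X\varphi\,d\mu_{\langle f\rangle}=2\mathcal E(f\varphi,f)-\mathcal E(\varphi,f^2)\qquad\text{for all }\varphi\in\mathcal F\cap C_c(X);$$ for general $f\in\mathcal F$, $\mu_{\langle f\rangle}$ is the finite measure with $\mu_{\langle f\rangle}(B)=\lim\mu_{\langle g\rangle}(B)$ for every Borel set $B$, as $g\to f$ in $\mathcal F$ through bounded $g\in\mathcal F$. For $f,g\in\mathcal F$ let $\mu_{\langle f,g\rangle}=\frac12\bigl(\mu_{\langle f+g\rangle}-\mu_{\langle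 f\rangle}-\mu_{\langle g\rangle}\bigr)$, a signed measure. A $\sigma$-finite Borel measure $\nu$ on $X$ is called a *minimal energy-dominant measure* if $\mu_{\langle f\rangle}\ll\nu$ for every $f\in\mathcal F$, and $\nu\ll\nu'$ for every $\sigma$-finite Borel measure $\nu'$ with the same property. Fix a minimal energy-dominant measure $\nu$. Let $p(\cdot)\colon X\to\{0,1,2,\dots\}\cup\{+\infty\}$ be the pointwise index, i.e. a $\nu$-measurable function such that for all $N\in\mathbb N$ and $f_1,\dots,f_N\in\mathcal F$ $$\operatorname{rank}\left(\frac{d\mu_{\langle f_i,f_j\rangle}}{d\nu}(x)\right)_{i,j=1}^N\le p(x)\qquad\text{for }\nu\text{-a.e. }x\in X,$$ and such that $p(x)\le p'(x)$ for $\nu$-a.e. $x$ whenever $p'$ is another such function. Assume that the index $p=\nu\text{-}\operatorname{ess\,sup}_{x\in X}p(x)$ is finite and greater than $0$, and equip $\mathcal F^p$ with the product topology. Let $\mathcal G$ be the set of all $(g_1,\dots,g_p)\in\mathcal F^p$ such that, for $\nu$-a.e. $x\in X$, the matrix $$\left(\frac{d\mu_{\langle g_i,g_j\rangle}}{d\nu}(x)\right)_{i,j=1}^{p(x)}$$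 of size $p(x)$ is invertible, and let $\hat{\mathcal G}$ be the set of all $(g_1,\dots,g_p)\in\mathcal G$ such that, for every $i=1,\dots,p$, $\mu_{\langle g_i\rangle}$ is a minimal energy-dominant measure. Then $\mathcal G$ and $\hat{\mathcal G}$ are both dense in $\mathcal F^p$. -/

import Mathlib

open MeasureTheory Filter Topology
open scoped ENNReal CompactlySupported

noncomputable section

namespace DirichletIndex

/-- A densely defined, symmetric, nonnegative definite bilinear form on `L²(X; m)`. -/
structure SymmetricForm {X : Type*} [MeasurableSpace X] (m : Measure X) where
  domain : Submodule ℝ (Lp ℝ 2 m)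
  form : domain →ₗ[ℝ] domain →ₗ[ℝ] ℝ
  dense_domain : Dense (domain : Set (Lp ℝ 2 m))
  symm : ∀ f g, form f g = form g f
  nonneg : ∀ f, 0 ≤ form f f

namespace SymmetricForm

variable {X : Type*} [MeasurableSpace X] {m : Measure X}

/-- The domain `F` of the form, as a type of its own: it carries the inner product
`E(f, g) + ∫ f g dm` and the corresponding topology, not the topology of `L²(X; m)`. -/
def Dom (E : SymmetricForm m) : Type _ := E.domain

instance (E : SymmetricForm m) : AddCommGroup E.Dom :=
  inferInstanceAs (AddCommGroup E.domain)

instance (E : SymmetricForm m) : Module ℝ E.Dom :=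
  inferInstanceAs (Module ℝ E.domain)

/-- The inclusion of `F` into `L²(X; m)`. -/
def toL2 (E : SymmetricForm m) : E.Dom →ₗ[ℝ] Lp ℝ 2 m := E.domain.subtype

/-- The form `E`, as a bilinear form on `F`. -/
def energy (E : SymmetricForm m) : E.Dom →ₗ[ℝ] E.Dom →ₗ[ℝ] ℝ := E.form

/-- The inner product `E(f, g) + ∫ f g dm` on `F`. -/
@[reducible] def core (E : SymmetricForm m) : InnerProductSpace.Core ℝ E.Dom where
  inner f g := E.energy f g + inner ℝ (E.toL2 f) (E.toL2 g)
  conj_inner_symm f g := by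
    have h : E.energy g f = E.energy f g := E.symm g f
    simp [h, real_inner_comm]
  re_inner_nonneg f := by
    have h : 0 ≤ E.energy f f := E.nonneg f
    have h' : 0 ≤ inner ℝ (E.toL2 f) (E.toL2 f) := real_inner_self_nonneg
    simpa using add_nonneg h h'
  add_left f g h := by
    simp only [map_add, LinearMap.add_apply, inner_add_left]
    ring
  smul_left f g r := by
    simp only [map_smul, LinearMap.smul_apply, real_inner_smul_left, smul_eq_mul]
    simp
    ring
  definite f hf := by
    have h : 0 ≤ E.energy f f := E.nonneg f
    have h' : 0 ≤ inner ℝ (E.toL2 f) (E.toL2 f) := real_inner_self_nonneg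
    have h0 : inner ℝ (E.toL2 f) (E.toL2 f) = 0 := by
      have : E.energy f f + inner ℝ (E.toL2 f) (E.toL2 f) = 0 := hf
      linarith
    have h1 : E.toL2 f = 0 := inner_self_eq_zero.1 h0
    exact Subtype.ext h1

instance (E : SymmetricForm m) : NormedAddCommGroup E.Dom := E.core.toNormedAddCommGroup

instance (E : SymmetricForm m) : InnerProductSpace ℝ E.Dom := InnerProductSpace.ofCore E.core.toCore

/-- The function `u` on `X` is a version of the element `f` of `F`. -/
def IsVersion (E : SymmetricForm m) (f : E.Dom) (u : X → ℝ) : Prop := E.toL2 f =ᵐ[m] u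

/-- `f` belongs to `F_b`, i.e. it is (essentially) bounded. -/
def IsBdd (E : SymmetricForm m) (f : E.Dom) : Prop := ∃ C : ℝ, ∀ᵐ x ∂m, |E.toL2 f x| ≤ C

/-- A Dirichlet form: the form is closed (its domain is complete for `E(f, f) + ∫ f² dm`) and
Markovian (the unit contraction `u ↦ (0 ∨ u) ∧ 1` operates on it). -/
structure IsDirichletForm (E : SymmetricForm m) : Prop where
  closed : CompleteSpace E.Dom
  markov : ∀ f : E.Dom, ∃ g : E.Dom,
    E.IsVersion g (fun x => min (max (E.toL2 f x) 0) 1) ∧ E.energy g g ≤ E.energy f f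

/-- Regularity: `F ∩ C_c(X)` is dense in `F`, and uniformly dense in `C_c(X)`. -/
structure IsRegular [TopologicalSpace X] (E : SymmetricForm m) : Prop where
  dense_dom : Dense {f : E.Dom | ∃ φ : C_c(X, ℝ), E.IsVersion f φ}
  dense_cc : ∀ (ψ : C_c(X, ℝ)) (ε : ℝ), 0 < ε →
    ∃ (φ : C_c(X, ℝ)) (f : E.Dom), E.IsVersion f φ ∧ ∀ x, |φ x - ψ x| < ε

/-- `supp[f]`, the support of the measure `|f| · m`. -/
def supp [TopologicalSpace X] (E : SymmetricForm m) (f : E.Dom) : Set X :=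
  (m.withDensity fun x => ‖E.toL2 f x‖ₑ).support

/-- Strong locality: `E(f, g) = 0` whenever `f`, `g` have compact supports and `g` is constant on
a neighbourhood of the support of `f`. -/
def IsStrongLocal [TopologicalSpace X] (E : SymmetricForm m) : Prop :=
  ∀ f g : E.Dom, IsCompact (E.supp f) → IsCompact (E.supp g) →
    (∃ U : Set X, IsOpen U ∧ E.supp f ⊆ U ∧ ∃ c : ℝ, ∀ᵐ x ∂m, x ∈ U → E.toL2 g x = c) →
    E.energy f g = 0

/-- The defining property of the energy measure of a bounded `f`: it is a Radon measure `μ` with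
`∫ φ dμ = 2 E(f φ, f) - E(φ, f²)` for all `φ ∈ F ∩ C_c(X)`. -/
structure IsBddEnergyMeasure [TopologicalSpace X] (E : SymmetricForm m) (f : E.Dom)
    (μ : Measure X) : Prop where
  radon : IsFiniteMeasureOnCompacts μ
  integral_eq : ∀ (φ : C_c(X, ℝ)) (φ' : E.Dom), E.IsVersion φ' φ →
    ∃ fφ fsq : E.Dom, E.IsVersion fφ (fun x => E.toL2 f x * φ x) ∧
      E.IsVersion fsq (fun x => E.toL2 f x ^ 2) ∧
      ∫ x, φ x ∂μ = 2 * E.energy fφ f - E.energy φ' fsq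

open Classical in
/-- The energy measure of a bounded `f ∈ F`. -/
def bddEnergyMeasure [TopologicalSpace X] (E : SymmetricForm m) (f : E.Dom) : Measure X :=
  if h : ∃ μ : Measure X, E.IsBddEnergyMeasure f μ then h.choose else 0

/-- The defining property of the energy measure of a general `f ∈ F`: it is the finite measure
which is the setwise limit of the energy measures of bounded `g`, as `g → f` in `F`. -/
structure IsEnergyMeasure [TopologicalSpace X] (E : SymmetricForm m) (f : E.Dom)
    (μ : Measure X) : Prop where
  finite : IsFiniteMeasure μ
  tendsto : ∀ B : Set X, MeasurableSet B →
    Tendsto (fun g => E.bddEnergyMeasure g B) (𝓝[{g | E.IsBdd g}] f) (𝓝 (μ B))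

open Classical in
/-- The energy measure `μ_⟨f⟩` of `f ∈ F`. -/
def energyMeasure [TopologicalSpace X] (E : SymmetricForm m) (f : E.Dom) : Measure X :=
  if h : ∃ μ : Measure X, E.IsEnergyMeasure f μ then h.choose else 0

instance [TopologicalSpace X] (E : SymmetricForm m) (f : E.Dom) :
    IsFiniteMeasure (E.energyMeasure f) := by
  unfold energyMeasure
  split_ifs with h
  · exact h.choose_spec.finite
  · infer_instance

/-- The mutual energy measure `μ_⟨f,g⟩ = (μ_⟨f+g⟩ - μ_⟨f⟩ - μ_⟨g⟩) / 2`. -/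
def mutualEnergyMeasure [TopologicalSpace X] (E : SymmetricForm m) (f g : E.Dom) :
    SignedMeasure X :=
  (1 / 2 : ℝ) • ((E.energyMeasure (f + g)).toSignedMeasure
    - (E.energyMeasure f).toSignedMeasure - (E.energyMeasure g).toSignedMeasure)

/-- `μ_⟨f⟩ ≪ ν` for every `f ∈ F`. -/
def IsEnergyDominant [TopologicalSpace X] (E : SymmetricForm m) (ν : Measure X) : Prop :=
  ∀ f : E.Dom, E.energyMeasure f ≪ ν

/-- Minimal energy-dominant measures. -/
structure IsMinimalEnergyDominant [TopologicalSpace X] (E : SymmetricForm m)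
    (ν : Measure X) : Prop where
  sigmaFinite : SigmaFinite ν
  dominant : E.IsEnergyDominant ν
  minimal : ∀ ν' : Measure X, SigmaFinite ν' → E.IsEnergyDominant ν' → ν ≪ ν'

/-- The matrix `(dμ_⟨f_i,f_j⟩/dν (x))_{i,j}`. -/
def gramMatrix [TopologicalSpace X] (E : SymmetricForm m) (ν : Measure X) {N : ℕ}
    (f : Fin N → E.Dom) (x : X) : Matrix (Fin N) (Fin N) ℝ :=
  Matrix.of fun i j => (E.mutualEnergyMeasure (f i) (f j)).rnDeriv ν x

/-- `q` bounds, `ν`-almost everywhere, the rank of all the matrices `(dμ_⟨f_i,f_j⟩/dν)_{i,j≤N}`. -/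
def BoundsRank [TopologicalSpace X] (E : SymmetricForm m) (ν : Measure X) (q : X → ℕ∞) : Prop :=
  ∀ (N : ℕ) (f : Fin N → E.Dom), ∀ᵐ x ∂ν, ((E.gramMatrix ν f x).rank : ℕ∞) ≤ q x

/-- `q` is (a version of) the pointwise index: the smallest `ν`-measurable function that bounds
the ranks. -/
structure IsPointwiseIndex [TopologicalSpace X] (E : SymmetricForm m) (ν : Measure X)
    (q : X → ℕ∞) : Prop where
  aemeasurable : AEMeasurable q ν
  boundsRank : E.BoundsRank ν q
  minimal : ∀ q' : X → ℕ∞, AEMeasurable q' ν → E.BoundsRank ν q' → ∀ᵐ x ∂ν, q x ≤ q' x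

/-- The set of all `g = (g_1, …, g_p) ∈ F^p` such that, for `ν`-a.e. `x`, the leading square block
of size `r = q(x)` of the matrix `(dμ_⟨g_i,g_j⟩/dν (x))_{i,j≤p}` is invertible. (It is used for
`p` the essential supremum of `q`, so that `q ≤ p` almost everywhere.) -/
def coordSet [TopologicalSpace X] (E : SymmetricForm m) (ν : Measure X) (q : X → ℕ∞) (p : ℕ) :
    Set (Fin p → E.Dom) :=
  {g | ∀ᵐ x ∂ν, ∀ (r : ℕ) (_ : q x = r) (hr : r ≤ p),
    IsUnit (E.gramMatrix ν (fun i : Fin r => g (Fin.castLE hr i)) x)}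

/-- The set of all `g` in `coordSet` all of whose components have minimal energy-dominant
energy measures. -/
def strongCoordSet [TopologicalSpace X] (E : SymmetricForm m) (ν : Measure X) (q : X → ℕ∞)
    (p : ℕ) : Set (Fin p → E.Dom) :=
  {g | g ∈ E.coordSet ν q p ∧ ∀ i, E.IsMinimalEnergyDominant (E.energyMeasure (g i))}

end SymmetricForm

end DirichletIndex

end

/-! Everything rests on one object: the densities `dμ_⟨f,g⟩/dν` form a symmetric, almost everywhere
positive semidefinite, continuous bilinear map `D` from `F × F` to `L¹(ν)` (`exists_density`). Once
`D` is available, density is a Baire category argument in the complete space `F^p`.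

Construction of `D`. The form is the limit of `β (f - T f, g)`, where `T` is `β` times the resolvent
at `β` and is a symmetric Markov operator. Pointwise inequalities for `T` pass to the limit: bounded
elements of `F` form an algebra, and `φ ↦ 2 E(fφ, f) - E(φ, f²)` is positive with mass at most `2
E(f, f)`. A positive extension and the Riesz representation theorem give `μ_⟨f⟩` for bounded `f`.
For each set `B`, `f ↦ μ_⟨f⟩(B)` is a quadratic form bounded by `2 ‖f‖²`, so it extends to all of
`F`.

Genericity. Let `A` be a set on which the index is at least `r`. The Gram determinant of `g + s h`
at `x` is a polynomial in `s`, nonzero as soon as `g` or `h` is nondegenerate at `x`; by Fubini some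
arbitrarily small `s` works for almost every `x` (`exists_small_perturbation`). Hence degenerate
sets can be intersected, and up to small sets there is a smallest one, `S`, on which all `r`-tuples
are degenerate (`exists_degenerate_set`). A positive semidefinite matrix of rank at least `r` has an
invertible principal `r`-block, so all Gram matrices have rank below `r` on `S`; by minimality of
the index, `S` is null. The tuples whose degenerate part of `A` has small measure therefore form a
dense set, open by `L¹` continuity of `D`, and their intersection is residual.

`𝒢` is the case of the level sets of the index and the first `r` components. The additional
condition for `𝒢̂` is the case `r = 1` on all of `X`, for each component: the index is at least `1`
almost everywhere, and an energy measure with nonvanishing density is minimal energy-dominant. -/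

noncomputable section

namespace DirichletIndex

/-! ### Pointwise and integral inequalities for symmetric Markov operators -/

section MarkovOperator

variable {X : Type*} [MeasurableSpace X] {m : Measure X}

/-- A symmetric Markov operator on `L²(X; m)`. -/
structure IsMarkovOp (T : Lp ℝ 2 m →ₗ[ℝ] Lp ℝ 2 m) : Prop where
  symm : ∀ u v, inner ℝ (T u) v = inner ℝ u (T v)
  markov : ∀ u : Lp ℝ 2 m, (∀ᵐ x ∂m, 0 ≤ u x ∧ u x ≤ 1) → ∀ᵐ x ∂m, 0 ≤ T u x ∧ T u x ≤ 1

theorem inner_L2 (u v : Lp ℝ 2 m) : inner ℝ u v = ∫ x, u x * v x ∂m := by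
  rw [L2.inner_def]
  exact integral_congr_ae (ae_of_all _ fun x => by simp [mul_comm])

theorem integrable_mul_L2 (u v : Lp ℝ 2 m) : Integrable (fun x => u x * v x) m :=
  MemLp.integrable_mul (Lp.memLp u) (Lp.memLp v)

/-- The product of an `L²` function and a bounded one lies in `L²`. -/
theorem exists_mul_L2 (u v : Lp ℝ 2 m) {M : ℝ} (hv : ∀ᵐ x ∂m, |v x| ≤ M) :
    ∃ w : Lp ℝ 2 m, w =ᵐ[m] fun x => u x * v x := by
  have h : MemLp (fun x => u x * v x) 2 m := by
    refine (Lp.memLp u).of_le_mul (c := M)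
      ((Lp.aestronglyMeasurable u).mul (Lp.aestronglyMeasurable v)) ?_
    filter_upwards [hv] with x hx
    rw [norm_mul, mul_comm, Real.norm_eq_abs (v x)]
    exact mul_le_mul_of_nonneg_right hx (norm_nonneg _)
  exact ⟨h.toLp _, h.coeFn_toLp⟩

/-- If a polynomial inequality holds at every rational `c` in `(-M, M)`, one may put `c = f x`. -/
theorem nonneg_of_forall_rat {M : ℝ} {F : ℝ → ℝ} (hF : Continuous F)
    (h : ∀ c : ℚ, |(c : ℝ)| < M → 0 ≤ F c) {y : ℝ} (hy : |y| < M) : 0 ≤ F y := by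
  have hcl : y ∈ closure ({z : ℝ | |z| < M} ∩ Set.range ((↑) : ℚ → ℝ)) := by
    have hopen : IsOpen {z : ℝ | |z| < M} := isOpen_lt continuous_abs continuous_const
    exact Rat.denseRange_cast.open_subset_closure_inter hopen hy
  refine closure_minimal ?_ (isClosed_le continuous_const hF) hcl
  rintro z ⟨hz, c, rfl⟩
  exact h c hz

theorem integrable_sq_L2 {f s : Lp ℝ 2 m} (hs : s =ᵐ[m] fun x => f x ^ 2) : Integrable s m := by
  refine (integrable_mul_L2 f f).congr ?_
  filter_upwards [hs] with x hx
  rw [hx, sq]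

namespace IsMarkovOp

variable {T : Lp ℝ 2 m →ₗ[ℝ] Lp ℝ 2 m} (hT : IsMarkovOp T)
include hT

theorem apply_mem_Icc {u : Lp ℝ 2 m} {C : ℝ} (hC : 0 < C)
    (hu : ∀ᵐ x ∂m, 0 ≤ u x ∧ u x ≤ C) : ∀ᵐ x ∂m, 0 ≤ T u x ∧ T u x ≤ C := by
  have h1 : ∀ᵐ x ∂m, 0 ≤ (C⁻¹ • u : Lp ℝ 2 m) x ∧ (C⁻¹ • u : Lp ℝ 2 m) x ≤ 1 := by
    filter_upwards [hu, Lp.coeFn_smul C⁻¹ u] with x hx h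
    rw [h, Pi.smul_apply, smul_eq_mul]
    refine ⟨mul_nonneg (by positivity) hx.1, ?_⟩
    rw [inv_mul_le_iff₀ hC]
    linarith [hx.2]
  have h2 := hT.markov _ h1
  rw [map_smul] at h2
  filter_upwards [h2, Lp.coeFn_smul C⁻¹ (T u)] with x hx h
  rw [h, Pi.smul_apply, smul_eq_mul, inv_mul_le_iff₀ hC] at hx
  refine ⟨?_, by linarith [hx.2]⟩
  by_contra hneg
  push Not at hneg
  have : C⁻¹ * T u x < 0 := mul_neg_of_pos_of_neg (by positivity) hneg
  linarith [hx.1]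

theorem apply_nonneg {u : Lp ℝ 2 m} {M : ℝ} (hu : ∀ᵐ x ∂m, 0 ≤ u x) (hM : ∀ᵐ x ∂m, u x ≤ M) :
    ∀ᵐ x ∂m, 0 ≤ T u x := by
  have : ∀ᵐ x ∂m, 0 ≤ T u x ∧ T u x ≤ max M 1 := by
    refine hT.apply_mem_Icc (by positivity) ?_
    filter_upwards [hu, hM] with x h1 h2
    exact ⟨h1, h2.trans (le_max_left _ _)⟩
  exact this.mono fun x hx => hx.1

/-- Write `u = u⁺ - u⁻`: then `T u⁺ ≥ 0` and `u⁻ ≤ k` gives `T u⁻ ≤ k`. This stands in for `T 1 ≤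
1`, since constants need not lie in `L²`. -/
theorem neg_le_apply {u : Lp ℝ 2 m} {M k : ℝ} (hk : 0 ≤ k) (hu : ∀ᵐ x ∂m, -k ≤ u x)
    (hM : ∀ᵐ x ∂m, u x ≤ M) : ∀ᵐ x ∂m, -k ≤ T u x := by
  have key : ∀ k : ℝ, 0 < k → (∀ᵐ x ∂m, -k ≤ u x) → ∀ᵐ x ∂m, -k ≤ T u x := by
    intro k hk hu
    have hp : ∀ᵐ x ∂m, 0 ≤ T (u ⊔ 0) x := by
      refine hT.apply_nonneg (M := max M 0) ?_ ?_
      · filter_upwards [Lp.coeFn_sup u 0, Lp.coeFn_zero ℝ 2 m] with x h h0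
        rw [h, Pi.sup_apply, h0]
        exact le_max_right _ _
      · filter_upwards [Lp.coeFn_sup u 0, Lp.coeFn_zero ℝ 2 m, hM] with x h h0 hx
        rw [h, Pi.sup_apply, h0]
        exact max_le_max hx le_rfl
    have hn : ∀ᵐ x ∂m, 0 ≤ T ((-u) ⊔ 0) x ∧ T ((-u) ⊔ 0) x ≤ k := by
      refine hT.apply_mem_Icc hk ?_
      filter_upwards [Lp.coeFn_sup (-u) 0, Lp.coeFn_zero ℝ 2 m, Lp.coeFn_neg u, hu] with x h h0 h1 hx
      rw [h, Pi.sup_apply, h0, h1]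
      exact ⟨le_max_right _ _, max_le (by simp only [Pi.neg_apply]; linarith) hk.le⟩
    have hdec : u = (u ⊔ 0) - ((-u) ⊔ 0) := by
      have := posPart_sub_negPart u
      rw [posPart_def, negPart_def] at this
      exact this.symm
    have : T u = T (u ⊔ 0) - T ((-u) ⊔ 0) := by rw [← map_sub, ← hdec]
    rw [this]
    filter_upwards [hp, hn, Lp.coeFn_sub (T (u ⊔ 0)) (T ((-u) ⊔ 0))] with x h1 h2 h3
    rw [h3, Pi.sub_apply]
    linarith [h2.2]
  -- The scaling argument needs a positive bound; `k = 0` is reached as a limit.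
  have hall : ∀ᵐ x ∂m, ∀ n : ℕ, -(k + 1 / ((n : ℝ) + 1)) ≤ T u x := by
    rw [ae_all_iff]
    intro n
    refine key _ (by positivity) ?_
    filter_upwards [hu] with x hx
    have : 0 < 1 / ((n : ℝ) + 1) := by positivity
    linarith
  filter_upwards [hall] with x hx
  have hlim : Tendsto (fun n : ℕ => -(k + 1 / ((n : ℝ) + 1))) atTop (𝓝 (-(k + 0))) :=
    (tendsto_const_nhds.add tendsto_one_div_add_atTop_nhds_zero_nat).neg
  have := le_of_tendsto' hlim hx
  simpa using this

/-- By symmetry the integral of `T u` over a set of finite measure is the pairing of `u` with `T e`,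
`e` the indicator, and `T e ≤ 1`. Exhausting `X` gives the `L¹` contraction. -/
theorem integrable_apply [SigmaFinite m] {u : Lp ℝ 2 m} {M : ℝ} (hu : ∀ᵐ x ∂m, 0 ≤ u x)
    (hM : ∀ᵐ x ∂m, u x ≤ M) (hi : Integrable u m) :
    Integrable (T u) m ∧ ∫ x, T u x ∂m ≤ ∫ x, u x ∂m := by
  have hTu := hT.apply_nonneg hu hM
  have hS : AECover m atTop (spanningSets m) :=
    { ae_eventually_mem := ae_of_all _ fun x => by
        filter_upwards [eventually_ge_atTop (spanningSetsIndex m x)] with n hn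
        exact monotone_spanningSets m hn (mem_spanningSetsIndex m x)
      measurableSet := measurableSet_spanningSets m }
  have hbd : ∀ n, ∫ x in spanningSets m n, T u x ∂m ≤ ∫ x, u x ∂m := by
    intro n
    have hmeas := measurableSet_spanningSets m n
    have hfin : m (spanningSets m n) ≠ ∞ := (measure_spanningSets_lt_top m n).ne
    set e : Lp ℝ 2 m := indicatorConstLp 2 hmeas hfin (1 : ℝ)
    have he : e =ᵐ[m] (spanningSets m n).indicator fun _ => (1 : ℝ) := indicatorConstLp_coeFn
    have h01 : ∀ᵐ x ∂m, 0 ≤ e x ∧ e x ≤ 1 := by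
      filter_upwards [he] with x hx
      rw [hx]
      by_cases h : x ∈ spanningSets m n <;> simp [h]
    have h1 : ∫ x in spanningSets m n, T u x ∂m = inner ℝ e (T u) := by
      rw [inner_L2, ← integral_indicator hmeas]
      refine integral_congr_ae ?_
      filter_upwards [he] with x hx
      rw [hx]
      by_cases h : x ∈ spanningSets m n <;> simp [h]
    rw [h1, ← hT.symm, inner_L2]
    refine integral_mono_ae (integrable_mul_L2 _ _) hi ?_
    filter_upwards [hT.markov e h01, hu] with x hx hux
    show T e x * u x ≤ u x
    nlinarith [hx.2]
  have hio : ∀ n, IntegrableOn (T u) (spanningSets m n) m := fun n =>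
    integrableOn_Lp_of_measure_ne_top _ one_le_two (measure_spanningSets_lt_top m n).ne
  have hint : Integrable (T u) m := by
    refine hS.integrable_of_integral_norm_bounded (∫ x, u x ∂m) hio (Eventually.of_forall fun n => ?_)
    refine le_trans (le_of_eq ?_) (hbd n)
    refine integral_congr_ae (ae_restrict_of_ae ?_)
    filter_upwards [hTu] with x hx
    exact Real.norm_of_nonneg hx
  refine ⟨hint, ?_⟩
  exact le_of_tendsto' (hS.integral_tendsto_of_countably_generated hint) hbd

/-- For constant `c`, `f² - 2cf ≥ -c²` because `(f - c)² ≥ 0`, and this bound survives `T`. A common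
null set for rational `c` allows `c = f x`. -/
theorem sq_defect_nonneg {f s : Lp ℝ 2 m} {M : ℝ} (hf : ∀ᵐ x ∂m, |f x| ≤ M)
    (hs : s =ᵐ[m] fun x => f x ^ 2) :
    ∀ᵐ x ∂m, 0 ≤ s x - 2 * f x * T f x + T s x := by
  have hall : ∀ᵐ x ∂m, ∀ c : ℚ, 0 ≤ T s x - 2 * c * T f x + (c : ℝ) ^ 2 := by
    rw [ae_all_iff]
    intro c
    have h1 : ∀ᵐ x ∂m, -(c : ℝ) ^ 2 ≤ T (s - (2 * (c : ℝ)) • f) x := by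
      refine hT.neg_le_apply (M := M ^ 2 + 2 * |(c : ℝ)| * M) (sq_nonneg _) ?_ ?_
      · filter_upwards [hs, Lp.coeFn_sub s ((2 * (c : ℝ)) • f), Lp.coeFn_smul (2 * (c : ℝ)) f]
          with x h1 h2 h3
        rw [h2, Pi.sub_apply, h3, Pi.smul_apply, h1, smul_eq_mul]
        nlinarith [sq_nonneg (f x - c)]
      · filter_upwards [hs, Lp.coeFn_sub s ((2 * (c : ℝ)) • f), Lp.coeFn_smul (2 * (c : ℝ)) f, hf]
          with x h1 h2 h3 h4
        rw [h2, Pi.sub_apply, h3, Pi.smul_apply, h1, smul_eq_mul]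
        have h5 : f x ^ 2 ≤ M ^ 2 := sq_le_sq' (by linarith [(abs_le.1 h4).1]) (abs_le.1 h4).2
        have h6 : -(c * f x) ≤ |(c : ℝ)| * M := by
          refine (neg_le_abs _).trans ?_
          rw [abs_mul]
          exact mul_le_mul_of_nonneg_left h4 (abs_nonneg _)
        linarith
    rw [map_sub, map_smul] at h1
    filter_upwards [h1, Lp.coeFn_sub (T s) ((2 * (c : ℝ)) • T f),
      Lp.coeFn_smul (2 * (c : ℝ)) (T f)] with x h1 h2 h3
    rw [h2, Pi.sub_apply, h3, Pi.smul_apply, smul_eq_mul] at h1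
    linarith
  filter_upwards [hall, hs] with x hx hsx
  have := nonneg_of_forall_rat (M := |f x| + 1)
    (F := fun c => T s x - 2 * c * T f x + c ^ 2) (by fun_prop) (fun c _ => hx c)
    (y := f x) (by linarith)
  rw [hsx]
  linarith

/-- The source is `(f² - c²)² ≤ 4M² (f - c)²` for `|f|, |c| < M`. With the constant terms moved to
one side it is a lower bound on an `L²` function, to which `T` is applied before setting `c = f x`.
-/
theorem quartic_defect_le {f s w : Lp ℝ 2 m} {M : ℝ} (hf : ∀ᵐ x ∂m, |f x| < M)
    (hs : s =ᵐ[m] fun x => f x ^ 2) (hw : w =ᵐ[m] fun x => s x ^ 2) :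
    ∀ᵐ x ∂m, T w x - 2 * s x * T s x + s x ^ 2
      ≤ 4 * M ^ 2 * (T s x - 2 * f x * T f x + s x) := by
  have hall : ∀ᵐ x ∂m, ∀ c : ℚ, |(c : ℝ)| < M →
      0 ≤ 4 * M ^ 2 * (T s x - 2 * c * T f x + (c : ℝ) ^ 2)
        - (T w x - 2 * (c : ℝ) ^ 2 * T s x + (c : ℝ) ^ 4) := by
    rw [ae_all_iff]
    intro c
    rw [Filter.eventually_imp_distrib_left]
    intro hc
    have hc2 : (c : ℝ) ^ 2 ≤ M ^ 2 :=
      sq_le_sq' (by linarith [(abs_lt.1 hc).1]) (abs_lt.1 hc).2.le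
    set h : Lp ℝ 2 m := (4 * M ^ 2 + 2 * (c : ℝ) ^ 2) • s - (8 * M ^ 2 * (c : ℝ)) • f - w with hh
    have hval : ∀ᵐ x ∂m, h x = (4 * M ^ 2 + 2 * (c : ℝ) ^ 2) * f x ^ 2 - 8 * M ^ 2 * c * f x
        - f x ^ 4 := by
      filter_upwards [hs, hw, Lp.coeFn_sub ((4 * M ^ 2 + 2 * (c : ℝ) ^ 2) • s
        - (8 * M ^ 2 * (c : ℝ)) • f) w, Lp.coeFn_sub ((4 * M ^ 2 + 2 * (c : ℝ) ^ 2) • s)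
        ((8 * M ^ 2 * (c : ℝ)) • f), Lp.coeFn_smul (4 * M ^ 2 + 2 * (c : ℝ) ^ 2) s,
        Lp.coeFn_smul (8 * M ^ 2 * (c : ℝ)) f] with x h1 h2 h3 h4 h5 h6
      rw [hh, h3, Pi.sub_apply, h4, Pi.sub_apply, h5, h6, Pi.smul_apply, Pi.smul_apply, h2, h1,
        smul_eq_mul, smul_eq_mul]
      ring
    have h1 : ∀ᵐ x ∂m, -(4 * M ^ 2 * (c : ℝ) ^ 2 - (c : ℝ) ^ 4) ≤ T h x := by
      refine hT.neg_le_apply (M := (4 * M ^ 2 + 2 * (c : ℝ) ^ 2) * M ^ 2 + 8 * M ^ 2 * (M * M))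
        (by nlinarith [sq_nonneg (c : ℝ)]) ?_ ?_
      · filter_upwards [hval, hf] with x hx hfx
        rw [hx]
        have h5 : (f x + c) ^ 2 ≤ (2 * M) ^ 2 :=
          sq_le_sq' (by linarith [(abs_lt.1 hc).1, (abs_lt.1 hfx).1])
            (by linarith [(abs_lt.1 hc).2, (abs_lt.1 hfx).2])
        nlinarith [mul_nonneg (sub_nonneg.2 h5) (sq_nonneg (f x - c))]
      · filter_upwards [hval, hf] with x hx hfx
        rw [hx]
        have h5 : f x ^ 2 ≤ M ^ 2 :=
          sq_le_sq' (by linarith [(abs_lt.1 hfx).1]) (abs_lt.1 hfx).2.le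
        have h6 : -(c * f x) ≤ M * M := by
          refine (neg_le_abs _).trans ?_
          rw [abs_mul]
          exact mul_le_mul hc.le hfx.le (abs_nonneg _) ((abs_nonneg _).trans hc.le)
        have h7 : (4 * M ^ 2 + 2 * (c : ℝ) ^ 2) * f x ^ 2
            ≤ (4 * M ^ 2 + 2 * (c : ℝ) ^ 2) * M ^ 2 :=
          mul_le_mul_of_nonneg_left h5 (by positivity)
        have h8 : 8 * M ^ 2 * -(c * f x) ≤ 8 * M ^ 2 * (M * M) :=
          mul_le_mul_of_nonneg_left h6 (by positivity)
        have h9 : 0 ≤ f x ^ 4 := by positivity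
        linarith
    have hTh : T h = (4 * M ^ 2 + 2 * (c : ℝ) ^ 2) • T s - (8 * M ^ 2 * (c : ℝ)) • T f - T w := by
      rw [hh, map_sub, map_sub, map_smul, map_smul]
    rw [hTh] at h1
    filter_upwards [h1, Lp.coeFn_sub ((4 * M ^ 2 + 2 * (c : ℝ) ^ 2) • T s
        - (8 * M ^ 2 * (c : ℝ)) • T f) (T w), Lp.coeFn_sub ((4 * M ^ 2 + 2 * (c : ℝ) ^ 2) • T s)
        ((8 * M ^ 2 * (c : ℝ)) • T f), Lp.coeFn_smul (4 * M ^ 2 + 2 * (c : ℝ) ^ 2) (T s),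
        Lp.coeFn_smul (8 * M ^ 2 * (c : ℝ)) (T f)] with x h1 h3 h4 h5 h6
    rw [h3, Pi.sub_apply, h4, Pi.sub_apply, h5, h6, Pi.smul_apply, Pi.smul_apply,
        smul_eq_mul, smul_eq_mul] at h1
    linarith
  filter_upwards [hall, hs, hf] with x hx hsx hfx
  have := nonneg_of_forall_rat (M := M)
    (F := fun c => 4 * M ^ 2 * (T s x - 2 * c * T f x + c ^ 2)
        - (T w x - 2 * c ^ 2 * T s x + c ^ 4)) (by fun_prop) hx hfx
  rw [hsx]
  linarith

/-- The approximating energy of `f²` is controlled by that of a bounded `f`. -/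
theorem inner_sq_sub_le [SigmaFinite m] {f s : Lp ℝ 2 m} {M : ℝ} (hf : ∀ᵐ x ∂m, |f x| < M)
    (hs : s =ᵐ[m] fun x => f x ^ 2) :
    inner ℝ s (s - T s) ≤ 4 * M ^ 2 * inner ℝ f (f - T f) := by
  have hsM : ∀ᵐ x ∂m, s x ≤ M ^ 2 := by
    filter_upwards [hs, hf] with x h1 h2
    rw [h1]
    exact sq_le_sq' (by linarith [(abs_lt.1 h2).1]) (abs_lt.1 h2).2.le
  have hs0 : ∀ᵐ x ∂m, 0 ≤ s x := by
    filter_upwards [hs] with x h1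
    rw [h1]; positivity
  obtain ⟨w, hw⟩ := exists_mul_L2 s s (M := M ^ 2) (by
    filter_upwards [hs0, hsM] with x h1 h2
    rwa [abs_of_nonneg h1])
  have hw' : w =ᵐ[m] fun x => s x ^ 2 := by
    filter_upwards [hw] with x hx
    rw [hx, sq]
  have his : Integrable s m := integrable_sq_L2 hs
  have hiw : Integrable w m := integrable_sq_L2 hw'
  -- The terms `T s` and `T w` enter the integrated quartic inequality only through `T h`. Since `h
  -- ≥ 0`, `∫ T h ≤ ∫ h` has the right sign even if `T` loses mass.
  set h : Lp ℝ 2 m := (4 * M ^ 2) • s - w with hh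
  have hhx : ∀ᵐ x ∂m, h x = 4 * M ^ 2 * s x - w x := by
    filter_upwards [Lp.coeFn_sub ((4 * M ^ 2) • s) w, Lp.coeFn_smul (4 * M ^ 2) s] with x h1 h2
    rw [hh, h1, Pi.sub_apply, h2, Pi.smul_apply, smul_eq_mul]
  have hThx : ∀ᵐ x ∂m, T h x = 4 * M ^ 2 * T s x - T w x := by
    rw [hh, map_sub, map_smul]
    filter_upwards [Lp.coeFn_sub ((4 * M ^ 2) • T s) (T w), Lp.coeFn_smul (4 * M ^ 2) (T s)]
      with x h1 h2
    rw [h1, Pi.sub_apply, h2, Pi.smul_apply, smul_eq_mul]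
  have hih : Integrable h m := ((his.const_mul _).sub hiw).congr (by
    filter_upwards [hhx] with x hx
    rw [hx]; rfl)
  obtain ⟨hiT, hle⟩ := hT.integrable_apply (u := h) (M := 4 * M ^ 2 * M ^ 2) (by
      filter_upwards [hhx, hw', hs0, hsM] with x h1 h2 h3 h4
      rw [h1, h2]
      nlinarith) (by
      filter_upwards [hhx, hw', hs0, hsM] with x h1 h2 h3 h4
      rw [h1, h2]
      nlinarith [sq_nonneg M]) hih
  have hq := hT.quartic_defect_le hf hs hw'
  have hi1 := integrable_mul_L2 s (T s)
  have hi2 := integrable_mul_L2 f (T f)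
  have key : 0 ≤ ∫ x, (T h x + (8 * M ^ 2) * (-(f x * T f x)) + 4 * M ^ 2 * s x
      + 2 * (s x * T s x) - w x) ∂m := by
    refine integral_nonneg_of_ae ?_
    filter_upwards [hq, hThx, hw'] with x h1 h2 h3
    simp only [Pi.zero_apply]
    rw [h2, h3]
    linarith
  have e1 : ∫ x, (T h x + (8 * M ^ 2) * (-(f x * T f x)) + 4 * M ^ 2 * s x
      + 2 * (s x * T s x) - w x) ∂m = ∫ x, T h x ∂m + (8 * M ^ 2) * (-∫ x, f x * T f x ∂m)
        + 4 * M ^ 2 * ∫ x, s x ∂m + 2 * ∫ x, s x * T s x ∂m - ∫ x, w x ∂m := by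
    rw [integral_sub, integral_add, integral_add, integral_add, integral_const_mul,
      integral_const_mul, integral_const_mul, integral_neg]
    all_goals fun_prop
  have e2 : ∫ x, h x ∂m = 4 * M ^ 2 * ∫ x, s x ∂m - ∫ x, w x ∂m := by
    rw [integral_congr_ae hhx, integral_sub, integral_const_mul]
    all_goals fun_prop
  have e3 : inner ℝ s s = ∫ x, w x ∂m := by
    rw [inner_L2]
    exact integral_congr_ae hw.symm
  have e4 : inner ℝ f f = ∫ x, s x ∂m := by
    rw [inner_L2]
    refine integral_congr_ae ?_
    filter_upwards [hs] with x hx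
    rw [hx, sq]
  rw [inner_sub_right, inner_sub_right, e3, e4, inner_L2, inner_L2]
  linarith

/-- The approximating energy measure of a bounded `f` is nonnegative. -/
theorem energy_functional_nonneg {f s φ fφ : Lp ℝ 2 m} {M : ℝ}
    (hf : ∀ᵐ x ∂m, |f x| ≤ M) (hs : s =ᵐ[m] fun x => f x ^ 2)
    (hφ : ∀ᵐ x ∂m, 0 ≤ φ x) (hfφ : fφ =ᵐ[m] fun x => f x * φ x) :
    0 ≤ 2 * inner ℝ fφ (f - T f) - inner ℝ φ (s - T s) := by
  have e1 : inner ℝ fφ f = inner ℝ φ s := by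
    rw [inner_L2, inner_L2]
    refine integral_congr_ae ?_
    filter_upwards [hs, hfφ] with x h1 h2
    rw [h1, h2]; ring
  -- By `e1` the functional is the integral of `φ` against the nonnegative defect of
  -- `sq_defect_nonneg`.
  have e2 : 0 ≤ ∫ x, (φ x * s x - 2 * (fφ x * T f x) + φ x * T s x) ∂m := by
    refine integral_nonneg_of_ae ?_
    filter_upwards [hT.sq_defect_nonneg hf hs, hφ, hfφ] with x h1 h2 h3
    rw [h3]
    have := mul_nonneg h2 h1
    simp only [Pi.zero_apply]
    linarith
  have i1 := integrable_mul_L2 φ s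
  have i2 := integrable_mul_L2 fφ (T f)
  have i3 := integrable_mul_L2 φ (T s)
  rw [integral_add (by fun_prop) (by fun_prop), integral_sub (by fun_prop) (by fun_prop),
    integral_const_mul, ← inner_L2, ← inner_L2, ← inner_L2] at e2
  rw [inner_sub_right, inner_sub_right, e1]
  linarith

/-- The approximating energy measure of a bounded `f` has total mass at most twice the energy. -/
theorem energy_functional_le [SigmaFinite m] {f s φ fφ : Lp ℝ 2 m} {M : ℝ}
    (hf : ∀ᵐ x ∂m, |f x| ≤ M) (hs : s =ᵐ[m] fun x => f x ^ 2)
    (hφ : ∀ᵐ x ∂m, φ x ≤ 1) (hfφ : fφ =ᵐ[m] fun x => f x * φ x) :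
    2 * inner ℝ fφ (f - T f) - inner ℝ φ (s - T s) ≤ 2 * inner ℝ f (f - T f) := by
  have hsM : ∀ᵐ x ∂m, s x ≤ M ^ 2 := by
    filter_upwards [hs, hf] with x h1 h2
    rw [h1]
    exact sq_le_sq' (by linarith [(abs_le.1 h2).1]) (abs_le.1 h2).2
  have hs0 : ∀ᵐ x ∂m, 0 ≤ s x := by
    filter_upwards [hs] with x h1
    rw [h1]; positivity
  have his : Integrable s m := integrable_sq_L2 hs
  obtain ⟨hiT, hle⟩ := hT.integrable_apply hs0 hsM his
  have e1 : inner ℝ fφ f = inner ℝ φ s := by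
    rw [inner_L2, inner_L2]
    refine integral_congr_ae ?_
    filter_upwards [hs, hfφ] with x h1 h2
    rw [h1, h2]; ring
  have e4 : inner ℝ f f = ∫ x, s x ∂m := by
    rw [inner_L2]
    refine integral_congr_ae ?_
    filter_upwards [hs] with x hx
    rw [hx, sq]
  have i1 := integrable_mul_L2 φ s
  have i2 := integrable_mul_L2 fφ (T f)
  have i3 := integrable_mul_L2 φ (T s)
  have i4 := integrable_mul_L2 f (T f)
  -- The defect is nonnegative, so `φ` may be replaced by `1`; `∫ T s ≤ ∫ s` then bounds the result
  -- by twice the approximating energy.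
  have e2 : ∫ x, (φ x * s x - 2 * (fφ x * T f x) + φ x * T s x) ∂m
      ≤ ∫ x, (s x - 2 * (f x * T f x) + T s x) ∂m := by
    refine integral_mono_ae (by fun_prop) (by fun_prop) ?_
    filter_upwards [hT.sq_defect_nonneg hf hs, hφ, hfφ] with x h1 h2 h3
    rw [h3]
    have := mul_nonneg (sub_nonneg.2 h2) h1
    linarith
  rw [integral_add (by fun_prop) (by fun_prop), integral_sub (by fun_prop) (by fun_prop),
    integral_add (by fun_prop) (by fun_prop), integral_sub (by fun_prop) (by fun_prop),
    integral_const_mul, integral_const_mul, ← inner_L2, ← inner_L2, ← inner_L2, ← inner_L2,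
    ← e4] at e2
  rw [inner_sub_right, inner_sub_right, inner_sub_right, e1]
  linarith

end IsMarkovOp

end MarkovOperator

/-! ### The form domain as a Hilbert space; resolvents and approximating forms -/

namespace SymmetricForm

variable {X : Type*} [MeasurableSpace X] {m : Measure X} (E : SymmetricForm m)

theorem inner_dom (f g : E.Dom) :
    inner ℝ f g = E.energy f g + inner ℝ (E.toL2 f) (E.toL2 g) := rfl

theorem energy_comm (f g : E.Dom) : E.energy f g = E.energy g f := E.symm f g

theorem energy_nonneg (f : E.Dom) : 0 ≤ E.energy f f := E.nonneg f

theorem norm_sq_dom (f : E.Dom) : ‖f‖ ^ 2 = E.energy f f + ‖E.toL2 f‖ ^ 2 := by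
  rw [← real_inner_self_eq_norm_sq, ← real_inner_self_eq_norm_sq, inner_dom]

theorem norm_toL2_le (f : E.Dom) : ‖E.toL2 f‖ ≤ ‖f‖ := by
  refine abs_le_of_sq_le_sq' ?_ (norm_nonneg _) |>.2
  rw [norm_sq_dom]
  linarith [E.energy_nonneg f]

theorem energy_le_norm_sq (f : E.Dom) : E.energy f f ≤ ‖f‖ ^ 2 := by
  rw [norm_sq_dom]
  linarith [sq_nonneg ‖E.toL2 f‖]

theorem abs_energy_le (f g : E.Dom) : |E.energy f g| ≤ 2 * ‖f‖ * ‖g‖ := by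
  have h1 : E.energy f g = inner ℝ f g - inner ℝ (E.toL2 f) (E.toL2 g) := by
    rw [inner_dom]; ring
  have h2 := abs_real_inner_le_norm f g
  have h3 := abs_real_inner_le_norm (E.toL2 f) (E.toL2 g)
  have h4 : ‖E.toL2 f‖ * ‖E.toL2 g‖ ≤ ‖f‖ * ‖g‖ :=
    mul_le_mul (E.norm_toL2_le f) (E.norm_toL2_le g) (norm_nonneg _) (norm_nonneg _)
  rw [h1]
  refine (abs_sub _ _).trans ?_
  linarith

theorem toL2_injective : Function.Injective E.toL2 := Subtype.val_injective

/-- The inclusion of the domain into `L²`, as a continuous linear map. -/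
def toL2L : E.Dom →L[ℝ] Lp ℝ 2 m :=
  E.toL2.mkContinuous 1 fun f => by rw [one_mul]; exact E.norm_toL2_le f

@[simp] theorem toL2L_apply (f : E.Dom) : E.toL2L f = E.toL2 f := rfl

/-- The energy form as a continuous bilinear map on the domain. -/
def energyL : E.Dom →L[ℝ] E.Dom →L[ℝ] ℝ :=
  E.energy.mkContinuous₂ 2 fun f g => E.abs_energy_le f g

@[simp] theorem energyL_apply (f g : E.Dom) : E.energyL f g = E.energy f g := rfl

theorem dense_range_toL2 : Dense (Set.range E.toL2) := by
  have : Set.range E.toL2 = (E.domain : Set (Lp ℝ 2 m)) := Subtype.range_coe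
  rw [this]
  exact E.dense_domain

section Complete

variable [CompleteSpace E.Dom]

/-- Against vectors in the range of the adjoint of `F → L²`, the inner product of `F` is an `L²`
pairing. As this range is dense in `F`, boundedness in `F` and `L²` convergence together give weak
convergence. -/
theorem inner_adjoint (h : Lp ℝ 2 m) (f : E.Dom) :
    inner ℝ f (E.toL2L.adjoint h) = inner ℝ (E.toL2 f) h := by
  rw [ContinuousLinearMap.adjoint_inner_right, toL2L_apply]

theorem adjoint_toL2L_injective : Function.Injective E.toL2L.adjoint := by
  rw [injective_iff_map_eq_zero]
  intro h hh
  have h1 : ∀ u ∈ Set.range E.toL2, inner ℝ u h = 0 := by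
    rintro u ⟨f, rfl⟩
    rw [← inner_adjoint, hh, inner_zero_right]
  exact E.dense_range_toL2.eq_zero_of_inner_left (𝕜 := ℝ) fun v hv => by
    rw [real_inner_comm]; exact h1 v hv

theorem denseRange_adjoint_toL2L : DenseRange E.toL2L.adjoint := by
  have h : (LinearMap.range E.toL2L.adjoint.toLinearMap).topologicalClosure = ⊤ := by
    rw [Submodule.topologicalClosure_eq_top_iff, Submodule.eq_bot_iff]
    intro f hf
    rw [Submodule.mem_orthogonal'] at hf
    have h1 : ∀ h, inner ℝ (E.toL2 f) h = 0 := fun h => by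
      rw [← inner_adjoint]
      exact hf _ ⟨h, rfl⟩
    have h2 : E.toL2 f = 0 := inner_self_eq_zero.1 (h1 (E.toL2 f))
    exact E.toL2_injective (by rw [h2, map_zero])
  have := Submodule.dense_iff_topologicalClosure_eq_top.2 h
  exact this

/-- A bounded sequence of `F` that converges in `L²` has its limit in `F`. -/
theorem exists_toL2_eq_of_bounded {f : ℕ → E.Dom} {C : ℝ} (hf : ∀ n, ‖f n‖ ≤ C)
    {u : Lp ℝ 2 m} (hu : Tendsto (fun n => E.toL2 (f n)) atTop (𝓝 u)) :
    ∃ w : E.Dom, E.toL2 w = u := by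
  set A := E.toL2L.adjoint
  let e := LinearEquiv.ofInjective A.toLinearMap E.adjoint_toL2L_injective
  -- The sought `w` must satisfy `⟨w, A h⟩ = (u, h)`. This prescribes a functional on the range of
  -- `A`, bounded by `C` as a limit; its Hahn–Banach extension is represented by `w`.
  let l : LinearMap.range A.toLinearMap →ₗ[ℝ] ℝ := (innerₗ _ u).comp e.symm.toLinearMap
  have hl : ∀ h, l (e h) = inner ℝ u h := fun h => by simp [l]
  have hbound : ∀ y, ‖l y‖ ≤ C * ‖y‖ := by
    intro y
    obtain ⟨h, rfl⟩ := e.surjective y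
    rw [hl]
    have hlim : Tendsto (fun n => ‖inner ℝ (E.toL2 (f n)) h‖) atTop (𝓝 ‖inner ℝ u h‖) :=
      (hu.inner tendsto_const_nhds).norm
    refine le_of_tendsto' hlim fun n => ?_
    rw [← inner_adjoint]
    refine (norm_inner_le_norm _ _).trans ?_
    exact mul_le_mul_of_nonneg_right (hf n) (norm_nonneg _)
  obtain ⟨g, hg, -⟩ := exists_extension_norm_eq _ (l.mkContinuous C hbound)
  refine ⟨(InnerProductSpace.toDual ℝ E.Dom).symm g, ?_⟩
  refine ext_inner_right ℝ fun h => ?_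
  rw [← inner_adjoint, InnerProductSpace.toDual_symm_apply]
  have := hg (e h)
  rw [LinearMap.mkContinuous_apply, hl] at this
  exact this

/-- A bounded sequence of `F` that converges in `L²` to an element of `F` converges weakly. -/
theorem tendsto_inner_of_bounded {f : ℕ → E.Dom} {C : ℝ} (hf : ∀ n, ‖f n‖ ≤ C) {w : E.Dom}
    (hu : Tendsto (fun n => E.toL2 (f n)) atTop (𝓝 (E.toL2 w))) (v : E.Dom) :
    Tendsto (fun n => inner ℝ (f n) v) atTop (𝓝 (inner ℝ w v)) := by
  have hd : ∀ n, ‖f n - w‖ ≤ C + ‖w‖ := fun n =>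
    (norm_sub_le _ _).trans (by linarith [hf n])
  have hC : 0 ≤ C + ‖w‖ := (norm_nonneg _).trans (hd 0)
  rw [Metric.tendsto_atTop]
  intro ε hε
  obtain ⟨h, hh⟩ := (E.denseRange_adjoint_toL2L).exists_dist_lt v
    (ε := ε / (2 * (C + ‖w‖ + 1))) (by positivity)
  have hlim : Tendsto (fun n => inner ℝ (E.toL2 (f n)) h) atTop (𝓝 (inner ℝ (E.toL2 w) h)) :=
    hu.inner tendsto_const_nhds
  obtain ⟨N, hN⟩ := (Metric.tendsto_atTop.1 hlim) (ε / 2) (by positivity)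
  refine ⟨N, fun n hn => ?_⟩
  have h1 := hN n hn
  rw [← inner_adjoint, ← inner_adjoint, Real.dist_eq, ← inner_sub_left] at h1
  rw [Real.dist_eq, ← inner_sub_left]
  have h2 : inner ℝ (f n - w) v = inner ℝ (f n - w) (v - E.toL2L.adjoint h)
      + inner ℝ (f n - w) (E.toL2L.adjoint h) := by rw [inner_sub_right]; ring
  have h3 : |inner ℝ (f n - w) (v - E.toL2L.adjoint h)| ≤ ε / 2 := by
    refine (abs_real_inner_le_norm _ _).trans ?_
    rw [dist_eq_norm] at hh
    calc ‖f n - w‖ * ‖v - E.toL2L.adjoint h‖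
        ≤ (C + ‖w‖ + 1) * (ε / (2 * (C + ‖w‖ + 1))) :=
          mul_le_mul (by linarith [hd n]) hh.le (norm_nonneg _) (by positivity)
      _ = ε / 2 := by field_simp
  rw [h2]
  refine (abs_add_le _ _).trans_lt ?_
  linarith

end Complete

/-- `R u` is the solution `w ∈ F` of `E(w, v) + β (w, v) = β (u, v)` for all `v ∈ F`. -/
def IsResolvent (β : ℝ) (R : Lp ℝ 2 m →ₗ[ℝ] E.Dom) : Prop :=
  ∀ u v, E.energy (R u) v = β * inner ℝ (u - E.toL2 (R u)) (E.toL2 v)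

theorem exists_isResolvent [CompleteSpace E.Dom] {β : ℝ} (hβ : 1 ≤ β) :
    ∃ R, E.IsResolvent β R := by
  let B : E.Dom →L[ℝ] E.Dom →L[ℝ] ℝ :=
    -- This is `E + β (·,·)` on `F`, written through the inner product of `F`. For `β ≥ 1` it
    -- dominates the squared norm, so Lax–Milgram applies with coercivity constant `1`.
    (1 - β) • E.energyL + β • (innerₗ E.Dom).mkContinuous₂ 1 fun f g => by
      rw [one_mul]; exact abs_real_inner_le_norm f g
  have hB : ∀ f g, B f g = E.energy f g + β * inner ℝ (E.toL2 f) (E.toL2 g) := fun f g => by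
    show (1 - β) * E.energy f g + β * inner ℝ f g = _
    rw [inner_dom]
    ring
  have hco : IsCoercive B := by
    refine ⟨1, one_pos, fun f => ?_⟩
    rw [hB, one_mul, ← sq, norm_sq_dom, real_inner_self_eq_norm_sq]
    nlinarith [sq_nonneg ‖E.toL2 f‖]
  refine ⟨(β • hco.continuousLinearEquivOfBilin.symm.toContinuousLinearMap.comp
    E.toL2L.adjoint).toLinearMap, fun u v => ?_⟩
  set w : E.Dom := hco.continuousLinearEquivOfBilin.symm (E.toL2L.adjoint u)
  have h1 : B w v = inner ℝ u (E.toL2 v) := by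
    rw [← hco.continuousLinearEquivOfBilin_apply, ContinuousLinearEquiv.apply_symm_apply,
      real_inner_comm, inner_adjoint, real_inner_comm]
  show E.energy (β • w) v = β * inner ℝ (u - E.toL2 (β • w)) (E.toL2 v)
  rw [hB] at h1
  rw [map_smul, map_smul, LinearMap.smul_apply, inner_sub_left, real_inner_smul_left, smul_eq_mul]
  rw [← h1]
  ring

namespace IsResolvent

variable {E} {β : ℝ} {R : Lp ℝ 2 m →ₗ[ℝ] E.Dom}

theorem inner_symm (hR : E.IsResolvent β R) (hβ : 0 < β) (u v : Lp ℝ 2 m) :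
    inner ℝ (E.toL2 (R u)) v = inner ℝ u (E.toL2 (R v)) := by
  have h1 := hR u (R v)
  have h2 := hR v (R u)
  rw [E.energy_comm, h1] at h2
  have h3 := mul_left_cancel₀ hβ.ne' h2
  rw [inner_sub_left, inner_sub_left, real_inner_comm (E.toL2 (R v)) (E.toL2 (R u))] at h3
  rw [real_inner_comm v]
  linarith

/-- `R u` is the minimizer of `E(w, w) + β ‖w - u‖²`. If `0 ≤ u ≤ 1`, the unit contraction of `R u`
increases neither term, so by uniqueness it equals `R u`. -/
theorem isMarkovOp (hE : E.IsDirichletForm) (hR : E.IsResolvent β R) (hβ : 0 < β) :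
    IsMarkovOp (E.toL2 ∘ₗ R) where
  symm u v := hR.inner_symm hβ u v
  markov u hu := by
    obtain ⟨g, hg, hgE⟩ := hE.markov (R u)
    set w := R u with hw
    have hle : ‖E.toL2 g - u‖ ≤ ‖E.toL2 w - u‖ := by
      refine Lp.norm_le_norm_of_ae_le ?_
      filter_upwards [hg, hu, Lp.coeFn_sub (E.toL2 g) u, Lp.coeFn_sub (E.toL2 w) u]
        with x h1 h2 h3 h4
      rw [h3, h4, Pi.sub_apply, Pi.sub_apply, h1, Real.norm_eq_abs, Real.norm_eq_abs]
      obtain ⟨h5, h6⟩ := h2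
      rcases le_total (E.toL2 w x) 0 with h | h
      · rw [max_eq_right h, min_eq_left zero_le_one, abs_le]
        rw [abs_of_nonpos (by linarith)]
        constructor <;> linarith
      · rw [max_eq_left h]
        rcases le_total (E.toL2 w x) 1 with h' | h'
        · rw [min_eq_left h']
        · rw [min_eq_right h', abs_of_nonneg (by linarith), abs_of_nonneg (by linarith)]
          linarith
    have hle2 : ‖E.toL2 g - u‖ ^ 2 ≤ ‖E.toL2 w - u‖ ^ 2 :=
      pow_le_pow_left₀ (norm_nonneg _) hle 2
    have hexp : E.energy g g = E.energy w w + 2 * E.energy w (g - w)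
        + E.energy (g - w) (g - w) := by
      simp only [map_sub, LinearMap.sub_apply]
      rw [E.energy_comm g w]
      ring
    have hexp2 : ‖E.toL2 g - u‖ ^ 2 = ‖E.toL2 w - u‖ ^ 2
        + 2 * inner ℝ (E.toL2 w - u) (E.toL2 (g - w)) + ‖E.toL2 (g - w)‖ ^ 2 := by
      rw [← norm_add_sq_real, map_sub]
      congr 2
      abel
    have hopt := hR u (g - w)
    rw [← hw, ← neg_sub (E.toL2 w) u, inner_neg_left] at hopt
    have h0 : ‖E.toL2 (g - w)‖ ^ 2 = 0 := by
      refine le_antisymm ?_ (sq_nonneg _)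
      have h1 := E.energy_nonneg (g - w)
      have h2 : β * ‖E.toL2 g - u‖ ^ 2 ≤ β * ‖E.toL2 w - u‖ ^ 2 :=
        mul_le_mul_of_nonneg_left hle2 hβ.le
      rw [hexp2] at h2
      have h3 : β * ‖E.toL2 (g - w)‖ ^ 2 ≤ 0 := by nlinarith
      by_contra hneg
      push Not at hneg
      nlinarith [mul_pos hβ hneg]
    have heq : E.toL2 g = E.toL2 w := by
      have : ‖E.toL2 (g - w)‖ = 0 := by simpa using h0
      rw [norm_eq_zero, map_sub, sub_eq_zero] at this
      exact this
    show ∀ᵐ x ∂m, 0 ≤ E.toL2 w x ∧ E.toL2 w x ≤ 1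
    rw [← heq]
    filter_upwards [hg] with x hx
    rw [hx]
    exact ⟨le_min (le_max_right _ _) zero_le_one, min_le_right _ _⟩

theorem energy_add (hR : E.IsResolvent β R) (u : Lp ℝ 2 m) :
    β * inner ℝ (u - E.toL2 (R u)) u
      = E.energy (R u) (R u) + β * ‖u - E.toL2 (R u)‖ ^ 2 := by
  rw [hR, ← real_inner_self_eq_norm_sq, inner_sub_right]
  ring

theorem energy_apply_le (hR : E.IsResolvent β R) (hβ : 0 < β) (f : E.Dom) :
    E.energy (R (E.toL2 f)) f ≤ E.energy f f := by
  set g := R (E.toL2 f)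
  have h1 := hR.energy_add (E.toL2 f)
  rw [← hR] at h1
  have h2 := E.energy_nonneg (f - g)
  have h3 : 0 ≤ β * ‖E.toL2 f - E.toL2 g‖ ^ 2 := by positivity
  simp only [map_sub, LinearMap.sub_apply] at h2
  rw [E.energy_comm f g] at h2
  linarith

end IsResolvent

section Limits

variable {E} {R : ℕ → Lp ℝ 2 m →ₗ[ℝ] E.Dom}

/-- By `energy_add` the approximating energy of `u` is a sum of two nonnegative terms, the energy of
`R n u` and `n + 1` times its squared `L²` distance from `u`; one bound controls both. -/
theorem tendsto_resolvent (hR : ∀ n : ℕ, E.IsResolvent ((n : ℝ) + 1) (R n)) {u : Lp ℝ 2 m}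
    {C : ℝ} (hC : ∀ n : ℕ, ((n : ℝ) + 1) * inner ℝ (u - E.toL2 (R n u)) u ≤ C) :
    (∀ n, E.energy (R n u) (R n u) ≤ C) ∧
      Tendsto (fun n => E.toL2 (R n u)) atTop (𝓝 u) := by
  have h1 : ∀ n : ℕ, E.energy (R n u) (R n u) + ((n : ℝ) + 1) * ‖u - E.toL2 (R n u)‖ ^ 2 ≤ C :=
    fun n => by rw [← (hR n).energy_add]; exact hC n
  refine ⟨fun n => ?_, ?_⟩
  · have : 0 ≤ ((n : ℝ) + 1) * ‖u - E.toL2 (R n u)‖ ^ 2 := by positivity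
    linarith [h1 n]
  · rw [tendsto_iff_norm_sub_tendsto_zero]
    have h2 : Tendsto (fun n => ‖E.toL2 (R n u) - u‖ ^ 2) atTop (𝓝 0) := by
      have h3 : Tendsto (fun n : ℕ => C * (1 / ((n : ℝ) + 1))) atTop (𝓝 (C * 0)) :=
        tendsto_one_div_add_atTop_nhds_zero_nat.const_mul C
      rw [mul_zero] at h3
      refine squeeze_zero (fun n => sq_nonneg _) (fun n => ?_) h3
      rw [norm_sub_rev, mul_one_div, le_div_iff₀ (by positivity)]
      linarith [h1 n, E.energy_nonneg (R n u)]
    have h4 := h2.sqrt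
    simpa [Real.sqrt_sq_eq_abs] using h4

theorem norm_resolvent_le {u : Lp ℝ 2 m} {C : ℝ}
    (h1 : ∀ n, E.energy (R n u) (R n u) ≤ C)
    (h2 : Tendsto (fun n => E.toL2 (R n u)) atTop (𝓝 u)) : ∃ C', ∀ n, ‖R n u‖ ≤ C' := by
  obtain ⟨K, hK⟩ := h2.norm.bddAbove_range
  refine ⟨C + K ^ 2 + 1, fun n => ?_⟩
  have h3 : ‖E.toL2 (R n u)‖ ≤ K := hK ⟨n, rfl⟩
  have h4 : ‖E.toL2 (R n u)‖ ^ 2 ≤ K ^ 2 := pow_le_pow_left₀ (norm_nonneg _) h3 2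
  have h5 := E.norm_sq_dom (R n u)
  nlinarith [h1 n, sq_nonneg (‖R n u‖ - 1)]

/-- An `L²` function whose approximating energies are bounded lies in `F`. -/
theorem exists_toL2_eq_of_energy_le [CompleteSpace E.Dom]
    (hR : ∀ n : ℕ, E.IsResolvent ((n : ℝ) + 1) (R n)) {u : Lp ℝ 2 m}
    {C : ℝ} (hC : ∀ n : ℕ, ((n : ℝ) + 1) * inner ℝ (u - E.toL2 (R n u)) u ≤ C) :
    ∃ f : E.Dom, E.toL2 f = u := by
  obtain ⟨h1, h2⟩ := tendsto_resolvent hR hC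
  obtain ⟨C', hC'⟩ := norm_resolvent_le h1 h2
  exact E.exists_toL2_eq_of_bounded hC' h2

theorem resolvent_energy_le (hR : ∀ n : ℕ, E.IsResolvent ((n : ℝ) + 1) (R n)) (f : E.Dom)
    (n : ℕ) : ((n : ℝ) + 1) * inner ℝ (E.toL2 f - E.toL2 (R n (E.toL2 f))) (E.toL2 f)
      ≤ E.energy f f := by
  rw [← hR n]
  exact (hR n).energy_apply_le (by positivity) f

/-- The approximating forms converge to the form. -/
theorem tendsto_approx_energy [CompleteSpace E.Dom]
    (hR : ∀ n : ℕ, E.IsResolvent ((n : ℝ) + 1) (R n)) (f g : E.Dom) :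
    Tendsto (fun n : ℕ => ((n : ℝ) + 1) * inner ℝ (E.toL2 f - E.toL2 (R n (E.toL2 f)))
      (E.toL2 g)) atTop (𝓝 (E.energy f g)) := by
  obtain ⟨h1, h2⟩ := tendsto_resolvent hR (resolvent_energy_le hR f)
  obtain ⟨C', hC'⟩ := norm_resolvent_le h1 h2
  -- The resolvent equation turns the approximating form into `E(R n f, g)`, the difference of the
  -- inner products of `F` and of `L²`; the first converges weakly, the second strongly.
  have h3 := E.tendsto_inner_of_bounded hC' h2 g
  have h4 : Tendsto (fun n => inner ℝ (E.toL2 (R n (E.toL2 f))) (E.toL2 g)) atTop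
    (𝓝 (inner ℝ (E.toL2 f) (E.toL2 g))) := h2.inner tendsto_const_nhds
  have h5 := h3.sub h4
  simp only [inner_dom, add_sub_cancel_right] at h5
  refine h5.congr fun n => ?_
  rw [hR n]

end Limits

end SymmetricForm

/-! ### The algebra of bounded elements and the energy functional -/

namespace SymmetricForm

section Algebra

variable {X : Type*} [MeasurableSpace X] {m : Measure X} {E : SymmetricForm m}

theorem IsVersion.add {f g : E.Dom} {u v : X → ℝ} (hf : E.IsVersion f u) (hg : E.IsVersion g v) :
    E.IsVersion (f + g) (fun x => u x + v x) := by
  have := Lp.coeFn_add (E.toL2 f) (E.toL2 g)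
  rw [← map_add] at this
  filter_upwards [this, hf, hg] with x h1 h2 h3
  rw [h1, Pi.add_apply, h2, h3]

theorem IsVersion.smul {f : E.Dom} {u : X → ℝ} (c : ℝ) (hf : E.IsVersion f u) :
    E.IsVersion (c • f) (fun x => c * u x) := by
  have := Lp.coeFn_smul c (E.toL2 f)
  rw [← map_smul] at this
  filter_upwards [this, hf] with x h1 h2
  rw [h1, Pi.smul_apply, h2, smul_eq_mul]

theorem IsVersion.congr {f : E.Dom} {u v : X → ℝ} (hf : E.IsVersion f u) (h : u =ᵐ[m] v) :
    E.IsVersion f v := EventuallyEq.trans hf h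

theorem IsVersion.unique {f g : E.Dom} {u : X → ℝ} (hf : E.IsVersion f u)
    (hg : E.IsVersion g u) : f = g :=
  E.toL2_injective (Lp.ext (EventuallyEq.trans hf hg.symm))

theorem isVersion_self (f : E.Dom) : E.IsVersion f (E.toL2 f) := EventuallyEq.rfl

theorem isVersion_zero : E.IsVersion 0 (fun _ => 0) := by
  have := Lp.coeFn_zero ℝ 2 m
  rw [← map_zero E.toL2] at this
  exact this

variable (E) in
/-- The bounded elements of the domain. -/
def bddDom : Submodule ℝ E.Dom where
  carrier := {f | E.IsBdd f}
  add_mem' := by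
    rintro f g ⟨C, hC⟩ ⟨D, hD⟩
    refine ⟨C + D, ?_⟩
    filter_upwards [hC, hD, (isVersion_self f).add (isVersion_self g)] with x h1 h2 h3
    rw [h3]
    exact (abs_add_le _ _).trans (add_le_add h1 h2)
  zero_mem' := ⟨0, by
    filter_upwards [isVersion_zero (E := E)] with x hx
    rw [hx, abs_zero]⟩
  smul_mem' := by
    rintro c f ⟨C, hC⟩
    refine ⟨|c| * C, ?_⟩
    filter_upwards [hC, (isVersion_self f).smul c] with x h1 h2
    rw [h2, abs_mul]
    exact mul_le_mul_of_nonneg_left h1 (abs_nonneg _)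

theorem exists_resolvent_seq (hE : E.IsDirichletForm) :
    ∃ R : ℕ → Lp ℝ 2 m →ₗ[ℝ] E.Dom, (∀ n : ℕ, E.IsResolvent ((n : ℝ) + 1) (R n)) ∧
      ∀ n, IsMarkovOp (E.toL2 ∘ₗ R n) := by
  have := hE.closed
  choose R hR using fun n : ℕ =>
    E.exists_isResolvent (β := (n : ℝ) + 1) (by linarith [n.cast_nonneg (α := ℝ)])
  exact ⟨R, hR, fun n => (hR n).isMarkovOp hE (by positivity)⟩

variable [SigmaFinite m]

/-- The approximating energies of `f²` are at most a constant times those of `f`, hence bounded, and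
an `L²` function with this property lies in `F`. -/
theorem exists_isVersion_sq (hE : E.IsDirichletForm) {f : E.Dom} (hf : E.IsBdd f) :
    ∃ g : E.Dom, E.IsVersion g (fun x => E.toL2 f x ^ 2) := by
  have := hE.closed
  obtain ⟨R, hR, hM⟩ := exists_resolvent_seq hE
  obtain ⟨C, hC⟩ := hf
  obtain ⟨s, hs⟩ := exists_mul_L2 (E.toL2 f) (E.toL2 f) hC
  have hs' : s =ᵐ[m] fun x => E.toL2 f x ^ 2 := by
    filter_upwards [hs] with x hx
    rw [hx, sq]
  obtain ⟨g, hg⟩ := exists_toL2_eq_of_energy_le hR (u := s)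
    (C := 4 * (C + 1) ^ 2 * E.energy f f) (fun n => by
      have h1 := (hM n).inner_sq_sub_le (M := C + 1) (f := E.toL2 f)
        (hC.mono fun x hx => by linarith) hs'
      have h2 := resolvent_energy_le hR f n
      simp only [LinearMap.comp_apply] at h1
      rw [real_inner_comm] at h1 h2
      have h3 : (0 : ℝ) ≤ (n : ℝ) + 1 := by positivity
      have h4 := mul_le_mul_of_nonneg_left h1 h3
      have h5 := mul_le_mul_of_nonneg_left h2 (a := 4 * (C + 1) ^ 2) (by positivity)
      linarith)
  exact ⟨g, by unfold IsVersion; rw [hg]; exact hs'⟩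

theorem exists_isVersion_mul (hE : E.IsDirichletForm) {f g : E.Dom} (hf : E.IsBdd f)
    (hg : E.IsBdd g) : ∃ h : E.Dom, E.IsVersion h (fun x => E.toL2 f x * E.toL2 g x) := by
  obtain ⟨a, ha⟩ := exists_isVersion_sq hE (E.bddDom.add_mem hf hg)
  obtain ⟨b, hb⟩ := exists_isVersion_sq hE hf
  obtain ⟨c, hc⟩ := exists_isVersion_sq hE hg
  refine ⟨(1 / 2 : ℝ) • (a + ((-1 : ℝ) • b + (-1 : ℝ) • c)),
    ((ha.add ((hb.smul _).add (hc.smul _))).smul _).congr ?_⟩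
  filter_upwards [(isVersion_self f).add (isVersion_self g)] with x hx
  rw [hx]
  ring

open Classical in
variable (E) in
/-- The product of two elements of the domain (`0` if it is not in the domain). -/
def mul (f g : E.Dom) : E.Dom :=
  if h : ∃ k : E.Dom, E.IsVersion k (fun x => E.toL2 f x * E.toL2 g x) then h.choose else 0

theorem isVersion_mul (hE : E.IsDirichletForm) {f g : E.Dom} (hf : E.IsBdd f) (hg : E.IsBdd g) :
    E.IsVersion (E.mul f g) (fun x => E.toL2 f x * E.toL2 g x) := by
  have h := exists_isVersion_mul hE hf hg
  rw [mul, dif_pos h]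
  exact h.choose_spec

theorem mul_comm_of_isBdd (hE : E.IsDirichletForm) {f g : E.Dom} (hf : E.IsBdd f) (hg : E.IsBdd g) :
    E.mul f g = E.mul g f :=
  (isVersion_mul hE hf hg).unique ((isVersion_mul hE hg hf).congr (ae_of_all _ fun _ =>
    mul_comm _ _))

theorem add_mul_of_isBdd (hE : E.IsDirichletForm) {f f' g : E.Dom} (hf : E.IsBdd f) (hf' : E.IsBdd f')
    (hg : E.IsBdd g) : E.mul (f + f') g = E.mul f g + E.mul f' g := by
  refine (isVersion_mul hE (E.bddDom.add_mem hf hf') hg).unique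
    (((isVersion_mul hE hf hg).add (isVersion_mul hE hf' hg)).congr ?_)
  filter_upwards [(isVersion_self f).add (isVersion_self f')] with x hx
  rw [hx, add_mul]

theorem smul_mul_of_isBdd (hE : E.IsDirichletForm) {f g : E.Dom} (c : ℝ) (hf : E.IsBdd f)
    (hg : E.IsBdd g) : E.mul (c • f) g = c • E.mul f g := by
  refine (isVersion_mul hE (E.bddDom.smul_mem c hf) hg).unique
    (((isVersion_mul hE hf hg).smul c).congr ?_)
  filter_upwards [(isVersion_self f).smul c] with x hx
  rw [hx, mul_assoc]

theorem mul_add_of_isBdd (hE : E.IsDirichletForm) {f f' g : E.Dom} (hf : E.IsBdd f) (hf' : E.IsBdd f')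
    (hg : E.IsBdd g) : E.mul g (f + f') = E.mul g f + E.mul g f' := by
  rw [mul_comm_of_isBdd hE hg (E.bddDom.add_mem hf hf'), add_mul_of_isBdd hE hf hf' hg, mul_comm_of_isBdd hE hf hg,
    mul_comm_of_isBdd hE hf' hg]

theorem mul_smul_of_isBdd (hE : E.IsDirichletForm) {f g : E.Dom} (c : ℝ) (hf : E.IsBdd f)
    (hg : E.IsBdd g) : E.mul g (c • f) = c • E.mul g f := by
  rw [mul_comm_of_isBdd hE hg (E.bddDom.smul_mem c hf), smul_mul_of_isBdd hE c hf hg, mul_comm_of_isBdd hE hf hg]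

variable (E) in
/-- The functional `φ ↦ 2 E(f φ, f) - E(φ, f²)` that represents the energy measure of `f`. -/
def energyFunctional (f φ : E.Dom) : ℝ :=
  2 * E.energy (E.mul f φ) f - E.energy φ (E.mul f f)

variable (E) in
/-- Twice the polarization of `energyFunctional`. -/
def mutualFunctional (f g φ : E.Dom) : ℝ :=
  2 * E.energy (E.mul f φ) g + 2 * E.energy (E.mul g φ) f - 2 * E.energy φ (E.mul f g)

theorem energyFunctional_add_right (hE : E.IsDirichletForm) {f φ ψ : E.Dom} (hf : E.IsBdd f)
    (hφ : E.IsBdd φ) (hψ : E.IsBdd ψ) :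
    E.energyFunctional f (φ + ψ) = E.energyFunctional f φ + E.energyFunctional f ψ := by
  simp only [energyFunctional, mul_add_of_isBdd hE hφ hψ hf, map_add, LinearMap.add_apply]
  ring

theorem energyFunctional_smul_right (hE : E.IsDirichletForm) {f φ : E.Dom} (c : ℝ)
    (hf : E.IsBdd f) (hφ : E.IsBdd φ) :
    E.energyFunctional f (c • φ) = c * E.energyFunctional f φ := by
  simp only [energyFunctional, mul_smul_of_isBdd hE c hφ hf, map_smul, LinearMap.smul_apply, smul_eq_mul]
  ring

theorem energyFunctional_smul (hE : E.IsDirichletForm) {f φ : E.Dom} (c : ℝ)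
    (hf : E.IsBdd f) (hφ : E.IsBdd φ) :
    E.energyFunctional (c • f) φ = c ^ 2 * E.energyFunctional f φ := by
  have hcf := E.bddDom.smul_mem c hf
  simp only [energyFunctional, smul_mul_of_isBdd hE c hf hφ, smul_mul_of_isBdd hE c hf hcf, mul_smul_of_isBdd hE c hf hf,
    map_smul, LinearMap.smul_apply, smul_eq_mul]
  ring

theorem energyFunctional_add (hE : E.IsDirichletForm) {f g φ : E.Dom}
    (hf : E.IsBdd f) (hg : E.IsBdd g) (hφ : E.IsBdd φ) :
    E.energyFunctional (f + g) φ
      = E.energyFunctional f φ + E.energyFunctional g φ + E.mutualFunctional f g φ := by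
  have hfg := E.bddDom.add_mem hf hg
  simp only [energyFunctional, mutualFunctional, add_mul_of_isBdd hE hf hg hφ, add_mul_of_isBdd hE hf hg hfg,
    mul_add_of_isBdd hE hf hg hf, mul_add_of_isBdd hE hf hg hg, map_add, LinearMap.add_apply]
  rw [mul_comm_of_isBdd hE hg hf]
  ring

theorem mutualFunctional_add (hE : E.IsDirichletForm) {f g h φ : E.Dom}
    (hf : E.IsBdd f) (hg : E.IsBdd g) (hh : E.IsBdd h) (hφ : E.IsBdd φ) :
    E.mutualFunctional (f + g) h φ = E.mutualFunctional f h φ + E.mutualFunctional g h φ := by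
  simp only [mutualFunctional, add_mul_of_isBdd hE hf hg hφ, add_mul_of_isBdd hE hf hg hh, map_add,
    LinearMap.add_apply]
  ring

theorem mutualFunctional_smul (hE : E.IsDirichletForm) {f h φ : E.Dom} (c : ℝ)
    (hf : E.IsBdd f) (hh : E.IsBdd h) (hφ : E.IsBdd φ) :
    E.mutualFunctional (c • f) h φ = c * E.mutualFunctional f h φ := by
  simp only [mutualFunctional, smul_mul_of_isBdd hE c hf hφ, smul_mul_of_isBdd hE c hf hh, map_smul,
    LinearMap.smul_apply, smul_eq_mul]
  ring

omit [SigmaFinite m] in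
theorem tendsto_energyFunctional (hE : E.IsDirichletForm) {R : ℕ → Lp ℝ 2 m →ₗ[ℝ] E.Dom}
    (hR : ∀ n : ℕ, E.IsResolvent ((n : ℝ) + 1) (R n)) {f φ : E.Dom} :
    Tendsto (fun n : ℕ => ((n : ℝ) + 1) *
      (2 * inner ℝ (E.toL2 (E.mul f φ)) (E.toL2 f - E.toL2 (R n (E.toL2 f)))
        - inner ℝ (E.toL2 φ) (E.toL2 (E.mul f f) - E.toL2 (R n (E.toL2 (E.mul f f))))))
      atTop (𝓝 (E.energyFunctional f φ)) := by
  have := hE.closed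
  have h1 := tendsto_approx_energy hR f (E.mul f φ)
  have h2 := tendsto_approx_energy hR (E.mul f f) φ
  have h3 := (h1.const_mul 2).sub h2
  rw [E.energy_comm f, E.energy_comm _ φ] at h3
  refine h3.congr fun n => ?_
  rw [real_inner_comm (E.toL2 (E.mul f φ)), real_inner_comm (E.toL2 φ)]
  ring

theorem isVersion_mul_self (hE : E.IsDirichletForm) {f : E.Dom} (hf : E.IsBdd f) :
    E.IsVersion (E.mul f f) (fun x => E.toL2 f x ^ 2) :=
  (isVersion_mul hE hf hf).congr (ae_of_all _ fun _ => (sq _).symm)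

theorem energyFunctional_nonneg (hE : E.IsDirichletForm) {f φ : E.Dom} (hf : E.IsBdd f)
    (hφ : E.IsBdd φ) (h0 : ∀ᵐ x ∂m, 0 ≤ E.toL2 φ x) : 0 ≤ E.energyFunctional f φ := by
  obtain ⟨R, hR, hM⟩ := exists_resolvent_seq hE
  obtain ⟨C, hC⟩ := id hf
  refine ge_of_tendsto' (tendsto_energyFunctional hE hR) fun n => ?_
  exact mul_nonneg (by positivity) ((hM n).energy_functional_nonneg hC
    (isVersion_mul_self hE hf) h0 (isVersion_mul hE hf hφ))

theorem energyFunctional_le (hE : E.IsDirichletForm) {f φ : E.Dom} (hf : E.IsBdd f)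
    (hφ : E.IsBdd φ) (h1 : ∀ᵐ x ∂m, E.toL2 φ x ≤ 1) :
    E.energyFunctional f φ ≤ 2 * E.energy f f := by
  have := hE.closed
  obtain ⟨R, hR, hM⟩ := exists_resolvent_seq hE
  obtain ⟨C, hC⟩ := id hf
  refine le_of_tendsto_of_tendsto' (tendsto_energyFunctional hE hR)
    ((tendsto_approx_energy hR f f).const_mul 2) fun n => ?_
  have h := (hM n).energy_functional_le hC
    (isVersion_mul_self hE hf) h1 (isVersion_mul hE hf hφ)
  have h2 := mul_le_mul_of_nonneg_left h (a := (n : ℝ) + 1) (by positivity)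
  simp only [LinearMap.comp_apply] at h2
  rw [real_inner_comm (E.toL2 f) (E.toL2 f - _)]
  refine h2.trans (le_of_eq ?_)
  ring

end Algebra

end SymmetricForm

/-! ### Energy measures of bounded elements by Riesz representation -/

namespace SymmetricForm

section EnergyMeasure

variable {X : Type*} [TopologicalSpace X] [MeasurableSpace X] {m : Measure X} {E : SymmetricForm m}

theorem isBdd_of_isVersion {φ : C_c(X, ℝ)} {f : E.Dom} (h : E.IsVersion f φ) : E.IsBdd f := by
  obtain ⟨C, hC⟩ := φ.hasCompactSupport.exists_bound_of_continuous φ.continuous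
  refine ⟨C, ?_⟩
  filter_upwards [h] with x hx
  rw [hx]
  exact hC x

/-- Twice a Urysohn function is approximated within `1` by an element of `F ∩ C_c`, which is then at
least `1` on `K`; the unit contraction makes it exactly `1` there. -/
theorem exists_isVersion_cutoff [LocallyCompactSpace X] [T2Space X] (hE : E.IsDirichletForm)
    (hreg : E.IsRegular) {K : Set X} (hK : IsCompact K) :
    ∃ (χ : C_c(X, ℝ)) (f : E.Dom), E.IsVersion f χ ∧ (∀ x, 0 ≤ χ x ∧ χ x ≤ 1) ∧
      ∀ x ∈ K, χ x = 1 := by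
  obtain ⟨ψ, hψK, -, hψc, hψ⟩ :=
    exists_continuous_one_zero_of_isCompact hK isClosed_empty (Set.disjoint_empty K)
  obtain ⟨φ, f, hf, hφ⟩ := hreg.dense_cc ((2 : ℝ) • (⟨ψ, hψc⟩ : C_c(X, ℝ))) 1 one_pos
  obtain ⟨g, hg, -⟩ := hE.markov f
  refine ⟨⟨⟨fun x => min (max (φ x) 0) 1, by fun_prop⟩,
    φ.hasCompactSupport.comp_left (g := fun y => min (max y 0) 1) (by simp)⟩, g, ?_, ?_, ?_⟩
  · refine hg.congr ?_
    filter_upwards [hf] with x hx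
    rw [hx]
    rfl
  · intro x
    exact ⟨le_min (le_max_right _ _) zero_le_one, min_le_right _ _⟩
  · intro x hx
    have h1 := hφ x
    have h2 : ψ x = 1 := hψK hx
    have h3 : ((2 : ℝ) • (⟨ψ, hψc⟩ : C_c(X, ℝ))) x = 2 := by
      show (2 : ℝ) * ψ x = 2
      rw [h2, mul_one]
    rw [h3, abs_lt] at h1
    have h4 : 1 ≤ φ x := by linarith [h1.1]
    show min (max (φ x) 0) 1 = 1
    exact min_eq_right (h4.trans (le_max_left _ _))

variable (E) in
/-- The Radon measure `μ` represents the functional `L` on `F ∩ C_c(X)`. -/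
structure Represents (μ : Measure X) (L : E.Dom → ℝ) : Prop where
  radon : IsFiniteMeasureOnCompacts μ
  integral_eq : ∀ (φ : C_c(X, ℝ)) (f : E.Dom), E.IsVersion f φ → ∫ x, φ x ∂μ = L f

theorem Represents.add [OpensMeasurableSpace X] {μ ν : Measure X} {L M : E.Dom → ℝ}
    (hμ : E.Represents μ L) (hν : E.Represents ν M) :
    E.Represents (μ + ν) (fun f => L f + M f) where
  radon := by
    have := hμ.radon
    have := hν.radon
    exact ⟨fun K hK => by
      rw [Measure.add_apply]
      exact ENNReal.add_lt_top.2 ⟨hK.measure_lt_top, hK.measure_lt_top⟩⟩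
  integral_eq φ f hf := by
    have := hμ.radon
    have := hν.radon
    rw [integral_add_measure φ.integrable φ.integrable, hμ.integral_eq φ f hf,
      hν.integral_eq φ f hf]

theorem Represents.smul {μ : Measure X} {L : E.Dom → ℝ} (c : NNReal)
    (hμ : E.Represents μ L) : E.Represents (c • μ) (fun f => c * L f) where
  radon := by
    have := hμ.radon
    exact ⟨fun K hK => by
      rw [Measure.smul_apply, ENNReal.smul_def, smul_eq_mul]
      exact ENNReal.mul_lt_top ENNReal.coe_lt_top hK.measure_lt_top⟩
  integral_eq φ f hf := by
    rw [integral_smul_nnreal_measure, hμ.integral_eq φ f hf, NNReal.smul_def, smul_eq_mul]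

theorem Represents.congr {μ : Measure X} {L M : E.Dom → ℝ} (hμ : E.Represents μ L)
    (h : ∀ f, E.IsBdd f → L f = M f) : E.Represents μ M where
  radon := hμ.radon
  integral_eq φ f hf := by rw [hμ.integral_eq φ f hf, h f (isBdd_of_isVersion hf)]

variable [LocallyCompactSpace X] [SecondCountableTopology X] [TopologicalSpace.MetrizableSpace X]
  [BorelSpace X] [SigmaFinite m]

/-- Uniform approximation alone does not control integrals against an infinite measure. Multiplying
the approximants by a cutoff `χ`, equal to `1` on the support of `ψ`, keeps them in `F` and bounds
the error by `∫ χ / (n + 1)`. -/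
theorem Represents.unique (hE : E.IsDirichletForm) (hreg : E.IsRegular) {μ ν : Measure X}
    {L : E.Dom → ℝ} (hμ : E.Represents μ L) (hν : E.Represents ν L) : μ = ν := by
  have := hμ.radon
  have := hν.radon
  have : IsLocallyFiniteMeasure μ := isLocallyFiniteMeasure_of_isFiniteMeasureOnCompacts
  have : IsLocallyFiniteMeasure ν := isLocallyFiniteMeasure_of_isFiniteMeasureOnCompacts
  refine Measure.ext_of_integral_eq_on_compactlySupported fun ψ => ?_
  obtain ⟨χ, c, hc, hχ, hχ1⟩ := exists_isVersion_cutoff hE hreg ψ.hasCompactSupport.isCompact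
  choose φ f hf hφ using fun n : ℕ => hreg.dense_cc ψ (1 / ((n : ℝ) + 1)) (by positivity)
  have hprod : ∀ n, E.IsVersion (E.mul (f n) c) (φ n * χ) := fun n =>
    (isVersion_mul hE (isBdd_of_isVersion (hf n)) (isBdd_of_isVersion hc)).congr
      ((hf n).mul hc)
  have hψχ : ∀ x, ψ x * χ x = ψ x := fun x => by
    by_cases hx : x ∈ tsupport ψ
    · rw [hχ1 x hx, mul_one]
    · rw [image_eq_zero_of_notMem_tsupport hx, zero_mul]
  have key : ∀ (ρ : Measure X) [IsFiniteMeasureOnCompacts ρ],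
      Tendsto (fun n => ∫ x, (φ n * χ) x ∂ρ) atTop (𝓝 (∫ x, ψ x ∂ρ)) := by
    intro ρ _
    rw [tendsto_iff_dist_tendsto_zero]
    have hlim : Tendsto (fun n : ℕ => (1 / ((n : ℝ) + 1)) * ∫ x, χ x ∂ρ) atTop
        (𝓝 (0 * ∫ x, χ x ∂ρ)) := tendsto_one_div_add_atTop_nhds_zero_nat.mul_const _
    rw [zero_mul] at hlim
    refine squeeze_zero (fun _ => dist_nonneg) (fun n => ?_) hlim
    rw [Real.dist_eq, ← integral_sub (φ n * χ).integrable ψ.integrable, ← integral_const_mul]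
    refine abs_integral_le_integral_abs.trans (integral_mono ?_ (χ.integrable.const_mul _) ?_)
    · exact ((φ n * χ).integrable.sub ψ.integrable).abs
    · intro x
      show |φ n x * χ x - ψ x| ≤ 1 / ((n : ℝ) + 1) * χ x
      rw [← hψχ x, ← sub_mul, abs_mul, abs_of_nonneg (hχ x).1]
      have h1 : |φ n x - ψ x * χ x| ≤ 1 / ((n : ℝ) + 1) := by
        rw [hψχ]; exact (hφ n x).le
      rw [hψχ] at h1
      exact mul_le_mul_of_nonneg_right h1 (hχ x).1
  refine tendsto_nhds_unique (key μ) ((key ν).congr fun n => ?_)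
  rw [hμ.integral_eq _ _ (hprod n), hν.integral_eq _ _ (hprod n)]

omit [SecondCountableTopology X] in
-- The functional is given only on `F ∩ C_c`. The M. Riesz extension theorem carries it, with
-- positivity, to `C_c`, where the Riesz–Markov–Kakutani theorem applies.
theorem exists_represents (hE : E.IsDirichletForm) (hreg : E.IsRegular) {f : E.Dom}
    (hf : E.IsBdd f) : ∃ μ : Measure X, E.Represents μ (E.energyFunctional f) := by
  let D : Submodule ℝ C_c(X, ℝ) :=
    { carrier := {φ | ∃ g : E.Dom, E.IsVersion g φ}
      add_mem' := by
        rintro φ ψ ⟨g, hg⟩ ⟨h, hh⟩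
        exact ⟨g + h, hg.add hh⟩
      zero_mem' := ⟨0, isVersion_zero⟩
      smul_mem' := by
        rintro c φ ⟨g, hg⟩
        exact ⟨c • g, hg.smul c⟩ }
  choose v hv using fun φ : D => φ.2
  have hb : ∀ φ, E.IsBdd (v φ) := fun φ => isBdd_of_isVersion (hv φ)
  let L : D →ₗ[ℝ] ℝ :=
    { toFun := fun φ => E.energyFunctional f (v φ)
      map_add' := fun φ ψ => by
        rw [← energyFunctional_add_right hE hf (hb φ) (hb ψ)]
        congr 1
        exact (hv (φ + ψ)).unique ((hv φ).add (hv ψ))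
      map_smul' := fun c φ => by
        rw [RingHom.id_apply, smul_eq_mul, ← energyFunctional_smul_right hE c hf (hb φ)]
        congr 1
        exact (hv (c • φ)).unique ((hv φ).smul c) }
  let S : PointedCone ℝ C_c(X, ℝ) :=
    { carrier := {φ | ∀ x, 0 ≤ φ x}
      add_mem' := fun {φ ψ} hφ hψ x => add_nonneg (hφ x) (hψ x)
      zero_mem' := fun x => le_rfl
      smul_mem' := fun c φ hφ x => mul_nonneg c.2 (hφ x) }
  obtain ⟨Λ, hΛ, hΛ0⟩ := riesz_extension S ⟨D, L⟩
    (fun φ hφ => energyFunctional_nonneg hE hf (hb φ) (by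
      filter_upwards [hv φ] with x hx
      rw [hx]
      exact hφ x))
    -- Cofinality: a multiple of a cutoff function dominates `-ψ`.
    (fun ψ => by
      obtain ⟨χ, c, hc, hχ, hχ1⟩ := exists_isVersion_cutoff hE hreg ψ.hasCompactSupport.isCompact
      obtain ⟨C, hC⟩ := ψ.hasCompactSupport.exists_bound_of_continuous ψ.continuous
      refine ⟨⟨C • χ, ⟨C • c, hc.smul C⟩⟩, fun x => ?_⟩
      show 0 ≤ C * χ x + ψ x
      by_cases hx : x ∈ tsupport ψ
      · rw [hχ1 x hx]
        linarith [neg_le_of_abs_le (hC x)]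
      · rw [image_eq_zero_of_notMem_tsupport hx, add_zero]
        exact mul_nonneg ((norm_nonneg _).trans (hC x)) (hχ x).1)
  refine ⟨RealRMK.rieszMeasure (PositiveLinearMap.mk₀ Λ fun φ hφ => hΛ0 φ hφ), inferInstance, ?_⟩
  intro φ g hg
  rw [RealRMK.integral_rieszMeasure]
  have h1 := hΛ ⟨φ, ⟨g, hg⟩⟩
  have h2 : v ⟨φ, ⟨g, hg⟩⟩ = g := (hv ⟨φ, ⟨g, hg⟩⟩).unique hg
  refine h1.trans ?_
  show E.energyFunctional f (v ⟨φ, ⟨g, hg⟩⟩) = _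
  rw [h2]

theorem Represents.measure_univ_le (hE : E.IsDirichletForm) (hreg : E.IsRegular) {f : E.Dom}
    (hf : E.IsBdd f) {μ : Measure X} (hμ : E.Represents μ (E.energyFunctional f)) :
    μ Set.univ ≤ ENNReal.ofReal (2 * E.energy f f) := by
  have := hμ.radon
  have : IsLocallyFiniteMeasure μ := isLocallyFiniteMeasure_of_isFiniteMeasureOnCompacts
  rw [isOpen_univ.measure_eq_iSup_isCompact μ]
  refine iSup_le fun K => iSup_le fun _ => iSup_le fun hK => ?_
  obtain ⟨χ, c, hc, hχ, hχ1⟩ := exists_isVersion_cutoff hE hreg hK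
  have h1 : ∫ x, χ x ∂μ ≤ 2 * E.energy f f := by
    rw [hμ.integral_eq χ c hc]
    refine energyFunctional_le hE hf (isBdd_of_isVersion hc) ?_
    filter_upwards [hc] with x hx
    rw [hx]
    exact (hχ x).2
  refine le_trans ?_ (ENNReal.ofReal_le_ofReal h1)
  rw [ofReal_integral_eq_lintegral_ofReal χ.integrable (ae_of_all _ fun x => (hχ x).1)]
  rw [← setLIntegral_one]
  refine (setLIntegral_mono' hK.measurableSet fun x hx => ?_).trans (setLIntegral_le_lintegral _ _)
  rw [hχ1 x hx, ENNReal.ofReal_one]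

omit [LocallyCompactSpace X] [SecondCountableTopology X] [TopologicalSpace.MetrizableSpace X]
  [BorelSpace X] in
-- The elements asserted to exist in the definition are determined by their versions, hence are the
-- products `mul f φ` and `mul f f`.
theorem isBddEnergyMeasure_iff (hE : E.IsDirichletForm) {f : E.Dom} (hf : E.IsBdd f)
    {μ : Measure X} : E.IsBddEnergyMeasure f μ ↔ E.Represents μ (E.energyFunctional f) := by
  constructor
  · intro h
    refine ⟨h.radon, fun φ g hg => ?_⟩
    obtain ⟨a, b, ha, hb, hab⟩ := h.integral_eq φ g hg
    have h1 : a = E.mul f g := ha.unique ((isVersion_mul hE hf (isBdd_of_isVersion hg)).congr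
      (EventuallyEq.rfl.mul hg))
    have h2 : b = E.mul f f := hb.unique (isVersion_mul_self hE hf)
    rw [hab, h1, h2, energyFunctional]
  · intro h
    refine ⟨h.radon, fun φ g hg => ⟨E.mul f g, E.mul f f, ?_, isVersion_mul_self hE hf,
      h.integral_eq φ g hg⟩⟩
    exact (isVersion_mul hE hf (isBdd_of_isVersion hg)).congr (EventuallyEq.rfl.mul hg)

theorem represents_bddEnergyMeasure (hE : E.IsDirichletForm) (hreg : E.IsRegular) {f : E.Dom}
    (hf : E.IsBdd f) : E.Represents (E.bddEnergyMeasure f) (E.energyFunctional f) := by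
  have h : ∃ μ, E.IsBddEnergyMeasure f μ := by
    obtain ⟨μ, hμ⟩ := exists_represents hE hreg hf
    exact ⟨μ, (isBddEnergyMeasure_iff hE hf).2 hμ⟩
  rw [bddEnergyMeasure, dif_pos h]
  exact (isBddEnergyMeasure_iff hE hf).1 h.choose_spec

end EnergyMeasure

end SymmetricForm

/-! ### Extension to all of F: the quadratic form attached to each set -/

namespace SymmetricForm

section EnergyForm

variable {X : Type*} [TopologicalSpace X] [LocallyCompactSpace X] [SecondCountableTopology X]
  [TopologicalSpace.MetrizableSpace X] [MeasurableSpace X] [BorelSpace X] {m : Measure X}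
  [SigmaFinite m] {E : SymmetricForm m}

theorem bddEnergyMeasure_univ_le (hE : E.IsDirichletForm) (hreg : E.IsRegular) {f : E.Dom}
    (hf : E.IsBdd f) : E.bddEnergyMeasure f Set.univ ≤ ENNReal.ofReal (2 * E.energy f f) :=
  (represents_bddEnergyMeasure hE hreg hf).measure_univ_le hE hreg hf

theorem isFiniteMeasure_bddEnergyMeasure (hE : E.IsDirichletForm) (hreg : E.IsRegular)
    {f : E.Dom} (hf : E.IsBdd f) : IsFiniteMeasure (E.bddEnergyMeasure f) :=
  ⟨(bddEnergyMeasure_univ_le hE hreg hf).trans_lt ENNReal.ofReal_lt_top⟩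

theorem bddEnergyMeasure_real_le (hE : E.IsDirichletForm) (hreg : E.IsRegular)
    {f : E.Dom} (hf : E.IsBdd f) (B : Set X) :
    (E.bddEnergyMeasure f).real B ≤ 2 * ‖f‖ ^ 2 := by
  have h0 := E.energy_nonneg f
  have h1 : (E.bddEnergyMeasure f).real B ≤ 2 * E.energy f f := by
    refine ENNReal.toReal_le_of_le_ofReal (by linarith) ?_
    exact (measure_mono (Set.subset_univ B)).trans (bddEnergyMeasure_univ_le hE hreg hf)
  linarith [E.energy_le_norm_sq f]

/-- Additivity of the polar form, arranged without subtraction so that both sides are measures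
representing one functional. The next lemma treats homogeneity in the same way. -/
theorem bddEnergyMeasure_add_add (hE : E.IsDirichletForm) (hreg : E.IsRegular) {f g h : E.Dom}
    (hf : E.IsBdd f) (hg : E.IsBdd g) (hh : E.IsBdd h) :
    E.bddEnergyMeasure (f + g + h) + E.bddEnergyMeasure f + E.bddEnergyMeasure g
        + E.bddEnergyMeasure h
      = E.bddEnergyMeasure (f + g) + E.bddEnergyMeasure (f + h) + E.bddEnergyMeasure (g + h) := by
  have hfg := E.bddDom.add_mem hf hg
  have r := fun {k : E.Dom} (hk : E.IsBdd k) => represents_bddEnergyMeasure hE hreg hk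
  refine ((((r (E.bddDom.add_mem hfg hh)).add (r hf)).add (r hg)).add (r hh)).unique hE hreg
    ((((r hfg).add (r (E.bddDom.add_mem hf hh))).add (r (E.bddDom.add_mem hg hh))).congr
      fun φ hφ => ?_)
  rw [energyFunctional_add hE hfg hh hφ, energyFunctional_add hE hf hg hφ,
    energyFunctional_add hE hf hh hφ, energyFunctional_add hE hg hh hφ,
    mutualFunctional_add hE hf hg hh hφ]
  ring

theorem bddEnergyMeasure_smul_add (hE : E.IsDirichletForm) (hreg : E.IsRegular) {f g : E.Dom}
    (hf : E.IsBdd f) (hg : E.IsBdd g) (t : NNReal) :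
    E.bddEnergyMeasure ((t : ℝ) • f + g) + t • E.bddEnergyMeasure f + t • E.bddEnergyMeasure g
      = t • E.bddEnergyMeasure (f + g) + (t ^ 2) • E.bddEnergyMeasure f
        + E.bddEnergyMeasure g := by
  have htf := E.bddDom.smul_mem (t : ℝ) hf
  have r := fun {k : E.Dom} (hk : E.IsBdd k) => represents_bddEnergyMeasure hE hreg hk
  refine (((r (E.bddDom.add_mem htf hg)).add ((r hf).smul t)).add ((r hg).smul t)).unique hE hreg
    (((((r (E.bddDom.add_mem hf hg)).smul t).add ((r hf).smul (t ^ 2))).add (r hg)).congr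
      fun φ hφ => ?_)
  rw [energyFunctional_add hE htf hg hφ, energyFunctional_add hE hf hg hφ,
    mutualFunctional_smul hE _ hf hg hφ, energyFunctional_smul hE _ hf hφ, NNReal.coe_pow]
  ring

omit [TopologicalSpace X] [LocallyCompactSpace X] [SecondCountableTopology X]
  [TopologicalSpace.MetrizableSpace X] [BorelSpace X] in
theorem measureReal_add_of_isFiniteMeasure (μ ν : Measure X) [IsFiniteMeasure μ]
    [IsFiniteMeasure ν] (B : Set X) : (μ + ν).real B = μ.real B + ν.real B :=
  measureReal_add_apply

/-- The bilinear form on bounded functions whose diagonal is `f ↦ μ_⟨f⟩(B)`. -/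
theorem exists_bdd_energyForm (hE : E.IsDirichletForm) (hreg : E.IsRegular) (B : Set X) :
    ∃ b : E.bddDom →ₗ[ℝ] E.bddDom →ₗ[ℝ] ℝ, (∀ f g, b f g = b g f) ∧
      ∀ f, b f f = (E.bddEnergyMeasure (f : E.Dom)).real B := by
  have hfin : ∀ f : E.bddDom, IsFiniteMeasure (E.bddEnergyMeasure (f : E.Dom)) := fun f =>
    isFiniteMeasure_bddEnergyMeasure hE hreg f.2
  set M : E.bddDom → ℝ := fun f => (E.bddEnergyMeasure (f : E.Dom)).real B with hM
  have h1 : ∀ f g h, M (f + g + h) + M f + M g + M h = M (f + g) + M (f + h) + M (g + h) := by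
    intro f g h
    have := congrArg (fun μ : Measure X => μ.real B) (bddEnergyMeasure_add_add hE hreg f.2 g.2 h.2)
    have i1 := hfin f
    have i2 := hfin g
    have i3 := hfin h
    have i4 := hfin (f + g)
    have i5 := hfin (f + h)
    have i6 := hfin (g + h)
    have i7 := hfin (f + g + h)
    simp only [Submodule.coe_add] at i4 i5 i6 i7
    simp only [measureReal_add_of_isFiniteMeasure] at this
    exact this
  have h2 : ∀ f g (t : NNReal), M ((t : ℝ) • f + g) + t * M f + t * M g
      = t * M (f + g) + (t : ℝ) ^ 2 * M f + M g := by
    intro f g t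
    have := congrArg (fun μ : Measure X => μ.real B) (bddEnergyMeasure_smul_add hE hreg f.2 g.2 t)
    have i1 := hfin f
    have i2 := hfin g
    have i4 := hfin (f + g)
    have i7 := hfin ((t : ℝ) • f + g)
    simp only [Submodule.coe_add, Submodule.coe_smul] at i4 i7
    simp only [measureReal_add_of_isFiniteMeasure, measureReal_nnreal_smul_apply,
      NNReal.coe_pow] at this
    exact this
  have h0 : M 0 = 0 := by
    have := h1 0 0 0
    simp only [add_zero] at this
    linarith
  have h3 : ∀ f (t : NNReal), M ((t : ℝ) • f) = (t : ℝ) ^ 2 * M f := by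
    intro f t
    have := h2 f 0 t
    simp only [add_zero, h0] at this
    linarith
  -- Homogeneity is known only for nonnegative scalars; evenness follows from additivity at `f, f,
  -- -f` together with `M (2f) = 4 M f`.
  have h4 : ∀ f, M (-f) = M f := by
    intro f
    have e1 := h1 f f (-f)
    have e2 := h3 f 2
    have e3 := h1 f (-f) (-f)
    have e4 := h3 (-f) 2
    simp only [NNReal.coe_ofNat, two_smul] at e2 e4
    simp only [add_neg_cancel_right, add_neg_cancel, h0, zero_add] at e1 e3
    linarith
  set β : E.bddDom → E.bddDom → ℝ := fun f g => (M (f + g) - M f - M g) / 2 with hβ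
  have hsymm : ∀ f g, β f g = β g f := by
    intro f g
    simp only [hβ, add_comm g f]
    ring
  have hadd : ∀ f g h, β (f + g) h = β f h + β g h := by
    intro f g h
    simp only [hβ]
    linarith [h1 f g h]
  have hneg : ∀ f g, β (-f) g = -β f g := by
    intro f g
    have e1 := hadd f (-f) g
    have e2 : β 0 g = 0 := by simp [hβ, h0]
    rw [add_neg_cancel, e2] at e1
    linarith
  have hsmul : ∀ (c : ℝ) f g, β (c • f) g = c * β f g := by
    have hpos : ∀ (t : NNReal) f g, β ((t : ℝ) • f) g = t * β f g := by
      intro t f g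
      simp only [hβ]
      rw [h3]
      linarith [h2 f g t]
    intro c f g
    rcases le_total 0 c with hc | hc
    · exact hpos ⟨c, hc⟩ f g
    · have : β ((-c) • f) g = -c * β f g := hpos ⟨-c, by linarith⟩ f g
      rw [neg_smul, hneg] at this
      linarith
  refine ⟨LinearMap.mk₂ ℝ β hadd (fun c f g => by rw [hsmul, smul_eq_mul])
    (fun f g h => by rw [hsymm, hadd, hsymm g f, hsymm h f])
    (fun c f g => by rw [hsymm, hsmul, hsymm g f, smul_eq_mul]), hsymm, fun f => ?_⟩
  show β f f = M f
  have e := h3 f 2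
  simp only [NNReal.coe_ofNat, two_smul] at e
  simp only [hβ, e]
  ring

theorem abs_le_of_diag_le {V : Type*} [SeminormedAddCommGroup V] [Module ℝ V]
    (b : V →ₗ[ℝ] V →ₗ[ℝ] ℝ) (hs : ∀ f g, b f g = b g f) (h0 : ∀ f, 0 ≤ b f f)
    (h2 : ∀ f, b f f ≤ 2 * ‖f‖ ^ 2) (f g : V) : |b f g| ≤ 2 * ‖f‖ * ‖g‖ := by
  have h : b f g ^ 2 ≤ b f f * b g g :=
    LinearMap.BilinForm.apply_sq_le_of_symm b h0 ⟨fun f g => hs f g⟩ f g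
  refine abs_le_of_sq_le_sq (h.trans ?_) (by positivity)
  calc b f f * b g g ≤ (2 * ‖f‖ ^ 2) * (2 * ‖g‖ ^ 2) :=
        mul_le_mul (h2 f) (h2 g) (h0 g) (by positivity)
    _ = _ := by ring

omit [LocallyCompactSpace X] [SecondCountableTopology X] [TopologicalSpace.MetrizableSpace X]
  [BorelSpace X] [SigmaFinite m] in
theorem denseRange_bddDom (hreg : E.IsRegular) : DenseRange E.bddDom.subtypeL := by
  have h : Dense (E.bddDom : Set E.Dom) := hreg.dense_dom.mono (by
    rintro f ⟨φ, hφ⟩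
    exact isBdd_of_isVersion hφ)
  exact h.denseRange_val

theorem exists_extended_energyForm (hE : E.IsDirichletForm) (hreg : E.IsRegular) (B : Set X) :
    ∃ b : E.Dom →L[ℝ] E.Dom →L[ℝ] ℝ, (∀ f g, b f g = b g f) ∧
      ∀ f, E.IsBdd f → b f f = (E.bddEnergyMeasure f).real B := by
  obtain ⟨b, hs, hb⟩ := exists_bdd_energyForm hE hreg B
  have hbound := abs_le_of_diag_le b hs (fun f => by rw [hb]; exact measureReal_nonneg)
    (fun f => by rw [hb]; exact bddEnergyMeasure_real_le hE hreg f.2 B)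
  have hd := denseRange_bddDom hreg
  let b1 : E.bddDom →L[ℝ] E.bddDom →L[ℝ] ℝ := b.mkContinuous₂ 2 hbound
  have hu : IsUniformInducing E.bddDom.subtypeL :=
    isUniformEmbedding_subtype_val.isUniformInducing
  -- Extension by continuity in one variable at a time; the flip exchanges the variables, which is
  -- harmless by symmetry.
  let b2 : E.Dom →L[ℝ] E.bddDom →L[ℝ] ℝ := b1.extend E.bddDom.subtypeL
  let b3 : E.Dom →L[ℝ] E.Dom →L[ℝ] ℝ := b2.flip.extend E.bddDom.subtypeL
  have h3 : ∀ f g : E.bddDom, b3 f g = b f g := by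
    intro f g
    have e1 : b3 (E.bddDom.subtypeL f) = b2.flip f := ContinuousLinearMap.extend_eq _ hd hu f
    have e2 : b2 (E.bddDom.subtypeL g) = b1 g := ContinuousLinearMap.extend_eq _ hd hu g
    calc b3 f g = b2.flip f (E.bddDom.subtypeL g) := congrArg (fun l => l (g : E.Dom)) e1
      _ = b2 (E.bddDom.subtypeL g) f := rfl
      _ = b1 g f := by rw [e2]
      _ = b f g := hs g f
  refine ⟨b3, fun f g => ?_, fun f hf => (h3 ⟨f, hf⟩ ⟨f, hf⟩).trans (hb ⟨f, hf⟩)⟩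
  refine hd.induction_on₂ (p := fun f g => b3 f g = b3 g f) ?_ (fun f g => ?_) f g
  · exact isClosed_eq (by fun_prop) (by fun_prop)
  · exact (h3 f g).trans ((hs f g).trans (h3 g f).symm)

/-- For fixed `f` the values `b B f f` are the setwise limits required of `μ_⟨f⟩`. What needs proof
is countable additivity in `B`, which comes from bounded approximants because the error bound is
uniform in `B`. -/
theorem exists_energyForm (hE : E.IsDirichletForm) (hreg : E.IsRegular) :
    ∃ b : Set X → E.Dom →L[ℝ] E.Dom →L[ℝ] ℝ, (∀ B f g, b B f g = b B g f) ∧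
      (∀ B f, 0 ≤ b B f f) ∧ (∀ B f, b B f f ≤ 2 * ‖f‖ ^ 2) ∧
      ∀ f B, MeasurableSet B → b B f f = (E.energyMeasure f).real B := by
  choose b hs hb using exists_extended_energyForm (E := E) hE hreg
  have hd := denseRange_bddDom hreg
  have h0 : ∀ B f, 0 ≤ b B f f := fun B f => by
    refine hd.induction_on (p := fun f => 0 ≤ b B f f) f ?_ fun g => ?_
    · exact isClosed_le (by fun_prop) (by fun_prop)
    · exact (hb B g g.2).symm ▸ measureReal_nonneg
  have h2 : ∀ B f, b B f f ≤ 2 * ‖f‖ ^ 2 := fun B f => by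
    refine hd.induction_on (p := fun f => b B f f ≤ 2 * ‖f‖ ^ 2) f ?_ fun g => ?_
    · exact isClosed_le (by fun_prop) (by fun_prop)
    · exact (hb B g g.2).symm ▸ bddEnergyMeasure_real_le hE hreg g.2 B
  refine ⟨b, hs, h0, h2, ?_⟩
  have hsum : ∀ f (A : ℕ → Set X), (∀ i, MeasurableSet (A i)) → Pairwise (Function.onFun Disjoint A) →
      HasSum (fun i => b (A i) f f) (b (⋃ i, A i) f f) := by
    intro f A hA hdis
    have hsplit : ∀ (s : Finset ℕ) (f : E.Dom), ∑ i ∈ s, b (A i) f f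
        + b ((⋃ i, A i) \ ⋃ i ∈ s, A i) f f = b (⋃ i, A i) f f := by
      intro s f
      refine hd.induction_on (p := fun f => ∑ i ∈ s, b (A i) f f
        + b ((⋃ i, A i) \ ⋃ i ∈ s, A i) f f = b (⋃ i, A i) f f) f ?_ fun g => ?_
      · exact isClosed_eq (by fun_prop) (by fun_prop)
      · have := isFiniteMeasure_bddEnergyMeasure hE hreg g.2
        simp only [Submodule.subtypeL_apply]
        simp only [hb _ _ g.2]
        rw [← measureReal_biUnion_finset (fun i _ j _ hij => hdis hij) fun i _ => hA i,
          measureReal_sdiff (Set.iUnion₂_subset fun i _ => Set.subset_iUnion A i)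
            (s.measurableSet_biUnion fun i _ => hA i)]
        ring
    -- Twice the value of the form at `f - g` minus its value at `f - 2g` is `b B f f - 2 b B g g`.
    have hbound : ∀ (B : Set X) (g : E.Dom), b B f f ≤ 2 * b B g g + 4 * ‖f - g‖ ^ 2 := by
      intro B g
      have e1 := h0 B (f - (2 : ℝ) • g)
      have e2 := h2 B (f - g)
      simp only [map_sub, sub_apply, map_smul, smul_apply,
        smul_eq_mul, hs B g f] at e1 e2
      linarith
    have hlim : Tendsto (fun s : Finset ℕ => b ((⋃ i, A i) \ ⋃ i ∈ s, A i) f f) atTop (𝓝 0) := by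
      rw [Metric.tendsto_atTop]
      intro ε hε
      obtain ⟨g, hg⟩ := hd.exists_dist_lt f (ε := Real.sqrt (ε / 8)) (by positivity)
      have hg2 : 4 * ‖f - (g : E.Dom)‖ ^ 2 < ε / 2 := by
        have : dist f (g : E.Dom) < Real.sqrt (ε / 8) := hg
        rw [dist_eq_norm] at this
        have h := Real.lt_sqrt (norm_nonneg _) |>.1 this
        linarith
      have := isFiniteMeasure_bddEnergyMeasure hE hreg g.2
      have hsm : HasSum (fun i => (E.bddEnergyMeasure (g : E.Dom)).real (A i))
          ((E.bddEnergyMeasure (g : E.Dom)).real (⋃ i, A i)) := by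
        have h := (E.bddEnergyMeasure (g : E.Dom)).toSignedMeasure.m_iUnion hA hdis
        simpa only [Measure.toSignedMeasure_apply_measurable, hA, MeasurableSet.iUnion hA] using h
      obtain ⟨s, hs'⟩ := Metric.tendsto_atTop.1 hsm (ε / 4) (by positivity)
      refine ⟨s, fun t ht => ?_⟩
      rw [Real.dist_eq, sub_zero, abs_of_nonneg (h0 _ _)]
      have e1 := hs' t ht
      have e2 := hsplit t (g : E.Dom)
      simp only [hb _ _ g.2] at e2
      rw [Real.dist_eq, ← e2, abs_lt] at e1
      have e3 := hbound ((⋃ i, A i) \ ⋃ i ∈ t, A i) g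
      rw [hb _ _ g.2] at e3
      linarith [e1.1]
    have h5 := (tendsto_const_nhds (x := b (⋃ i, A i) f f)).sub hlim
    rw [sub_zero] at h5
    exact h5.congr fun s => by rw [← hsplit s f]; ring
  intro f B hB
  have hex : ∃ μ, E.IsEnergyMeasure f μ := by
    have hempty : b ∅ f f = 0 := by
      refine hd.induction_on (p := fun f => b ∅ f f = 0) f ?_ fun g => ?_
      · exact isClosed_eq (by fun_prop) (by fun_prop)
      · rw [Submodule.subtypeL_apply, hb _ _ g.2, measureReal_empty]
    refine ⟨Measure.ofMeasurable (fun B _ => ENNReal.ofReal (b B f f)) (by simp [hempty])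
      (fun A hA hdis => ?_), ?_, ?_⟩
    · have := hsum f A hA hdis
      rw [← this.tsum_eq, ENNReal.ofReal_tsum_of_nonneg (fun i => h0 _ _) this.summable]
    · constructor
      rw [Measure.ofMeasurable_apply _ MeasurableSet.univ]
      exact ENNReal.ofReal_lt_top
    · intro B hB
      rw [Measure.ofMeasurable_apply _ hB]
      have hcont : Tendsto (fun g => ENNReal.ofReal (b B g g)) (𝓝[{g | E.IsBdd g}] f)
          (𝓝 (ENNReal.ofReal (b B f f))) := by
        have : Continuous fun g => ENNReal.ofReal (b B g g) :=
          ENNReal.continuous_ofReal.comp (by fun_prop)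
        exact this.continuousAt.tendsto.mono_left nhdsWithin_le_nhds
      refine hcont.congr' ?_
      filter_upwards [self_mem_nhdsWithin] with g hg
      have := isFiniteMeasure_bddEnergyMeasure hE hreg hg
      rw [hb B g hg, ofReal_measureReal]
  have hspec : E.IsEnergyMeasure f (E.energyMeasure f) := by
    rw [energyMeasure, dif_pos hex]
    exact hex.choose_spec
  -- Bounded elements are dense, so the defining limit is along a proper filter and determines the
  -- chosen `energyMeasure`.
  have hne : (𝓝[{g | E.IsBdd g}] f).NeBot := by
    rw [← mem_closure_iff_nhdsWithin_neBot]
    have : Dense (E.bddDom : Set E.Dom) := by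
      have h := hd
      rwa [DenseRange, Submodule.coe_subtypeL, Submodule.coe_subtype, Subtype.range_coe] at h
    exact this f
  have hlim1 := (ENNReal.tendsto_toReal (measure_ne_top (E.energyMeasure f) B)).comp
    (hspec.tendsto B hB)
  have hcont : Tendsto (fun g => b B g g) (𝓝[{g | E.IsBdd g}] f) (𝓝 (b B f f)) := by
    have : Continuous fun g => b B g g := by fun_prop
    exact this.continuousAt.tendsto.mono_left nhdsWithin_le_nhds
  refine tendsto_nhds_unique hcont (hlim1.congr' ?_)
  filter_upwards [self_mem_nhdsWithin] with g hg
  rw [hb B g hg]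
  rfl

end EnergyForm

end SymmetricForm

/-! ### Densities of mutual energy measures as a bilinear map into L¹ -/

namespace SymmetricForm

section Density

variable {X : Type*} [TopologicalSpace X] [LocallyCompactSpace X] [SecondCountableTopology X]
  [TopologicalSpace.MetrizableSpace X] [MeasurableSpace X] [BorelSpace X] {m : Measure X}
  [SigmaFinite m] {E : SymmetricForm m}

omit [LocallyCompactSpace X] [SecondCountableTopology X]
  [TopologicalSpace.MetrizableSpace X] [BorelSpace X] [SigmaFinite m] in
theorem mutualEnergyMeasure_apply (f g : E.Dom) {B : Set X} (hB : MeasurableSet B) :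
    E.mutualEnergyMeasure f g B = (1 / 2 : ℝ) * ((E.energyMeasure (f + g)).real B
      - (E.energyMeasure f).real B - (E.energyMeasure g).real B) := by
  simp only [mutualEnergyMeasure, smul_apply, sub_apply,
    Measure.toSignedMeasure_apply_measurable hB, smul_eq_mul]

omit [LocallyCompactSpace X] [SecondCountableTopology X]
  [TopologicalSpace.MetrizableSpace X] [BorelSpace X] [SigmaFinite m] in
theorem setIntegral_rnDeriv_mutualEnergyMeasure {ν : Measure X} [SigmaFinite ν]
    (hν : E.IsEnergyDominant ν) (f g : E.Dom) {B : Set X} (hB : MeasurableSet B) :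
    ∫ x in B, (E.mutualEnergyMeasure f g).rnDeriv ν x ∂ν = E.mutualEnergyMeasure f g B := by
  have hac : E.mutualEnergyMeasure f g ≪ᵥ ν.toENNRealVectorMeasure := by
    refine VectorMeasure.AbsolutelyContinuous.mk fun s hs h0 => ?_
    rw [Measure.toENNRealVectorMeasure_apply_measurable hs] at h0
    rw [mutualEnergyMeasure_apply f g hs, measureReal_def, measureReal_def, measureReal_def,
      hν _ h0, hν _ h0, hν _ h0]
    simp
  conv_rhs => rw [← SignedMeasure.withDensityᵥ_rnDeriv_eq _ ν hac]
  rw [withDensityᵥ_apply (SignedMeasure.integrable_rnDeriv _ _) hB]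

/-- The densities of the mutual energy measures, as a continuous bilinear map into `L¹(ν)`. -/
theorem exists_density (hE : E.IsDirichletForm) (hreg : E.IsRegular) {ν : Measure X}
    [SigmaFinite ν] (hν : E.IsEnergyDominant ν) :
    ∃ D : E.Dom →L[ℝ] E.Dom →L[ℝ] Lp ℝ 1 ν,
      (∀ f g, D f g =ᵐ[ν] (E.mutualEnergyMeasure f g).rnDeriv ν) ∧ (∀ f g, D f g = D g f) ∧
      (∀ f, 0 ≤ᵐ[ν] D f f) ∧
      ∀ f B, MeasurableSet B → ∫ x in B, D f f x ∂ν = (E.energyMeasure f).real B := by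
  obtain ⟨b, hs, h0, h2, hb⟩ := exists_energyForm hE hreg
  have hmut : ∀ f g B, MeasurableSet B → E.mutualEnergyMeasure f g B = b B f g := by
    intro f g B hB
    rw [mutualEnergyMeasure_apply f g hB, ← hb _ B hB, ← hb _ B hB, ← hb _ B hB]
    simp only [map_add, add_apply, hs B g f]
    ring
  set d : E.Dom → E.Dom → X → ℝ := fun f g => (E.mutualEnergyMeasure f g).rnDeriv ν with hd
  have hdi : ∀ f g, Integrable (d f g) ν := fun f g => SignedMeasure.integrable_rnDeriv _ _
  have hint : ∀ f g B, MeasurableSet B → ∫ x in B, d f g x ∂ν = b B f g := fun f g B hB => by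
    rw [← hmut f g B hB, ← setIntegral_rnDeriv_mutualEnergyMeasure hν f g hB]
  let D0 : E.Dom → E.Dom → Lp ℝ 1 ν := fun f g => (hdi f g).toL1 _
  have hD0 : ∀ f g, D0 f g =ᵐ[ν] d f g := fun f g => (hdi f g).coeFn_toL1
  have hD0int : ∀ f g B, MeasurableSet B → ∫ x in B, D0 f g x ∂ν = b B f g := fun f g B hB => by
    rw [← hint f g B hB]
    exact integral_congr_ae (ae_restrict_of_ae (hD0 f g))
  -- Elements of `L¹` are determined by their set integrals, so symmetry and bilinearity are
  -- inherited from `b B`.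
  have hext : ∀ u v : Lp ℝ 1 ν, (∀ B, MeasurableSet B → ∫ x in B, u x ∂ν = ∫ x in B, v x ∂ν) →
      u = v := fun u v h => Lp.ext
    (Integrable.ae_eq_of_forall_setIntegral_eq _ _ (L1.integrable_coeFn u) (L1.integrable_coeFn v)
      fun B hB _ => h B hB)
  have haddint : ∀ (u v : Lp ℝ 1 ν) B, ∫ x in B, (u + v) x ∂ν
      = ∫ x in B, u x ∂ν + ∫ x in B, v x ∂ν := fun u v B => by
    rw [← integral_add (L1.integrable_coeFn u).integrableOn (L1.integrable_coeFn v).integrableOn]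
    exact integral_congr_ae (ae_restrict_of_ae (Lp.coeFn_add u v))
  have hsmulint : ∀ (c : ℝ) (u : Lp ℝ 1 ν) B, ∫ x in B, (c • u) x ∂ν
      = c * ∫ x in B, u x ∂ν := fun c u B => by
    rw [← integral_const_mul]
    exact integral_congr_ae (ae_restrict_of_ae (Lp.coeFn_smul c u))
  have hsymm : ∀ f g, D0 f g = D0 g f := fun f g => hext _ _ fun B hB => by
    rw [hD0int _ _ _ hB, hD0int _ _ _ hB, hs]
  have hadd : ∀ f f' g, D0 (f + f') g = D0 f g + D0 f' g := fun f f' g => hext _ _ fun B hB => by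
    rw [haddint, hD0int _ _ _ hB, hD0int _ _ _ hB, hD0int _ _ _ hB, map_add, add_apply]
  have hsmul : ∀ (c : ℝ) f g, D0 (c • f) g = c • D0 f g := fun c f g => hext _ _ fun B hB => by
    rw [hsmulint, hD0int _ _ _ hB, hD0int _ _ _ hB, map_smul, smul_apply, smul_eq_mul]
  have hbabs : ∀ B f g, |b B f g| ≤ 2 * ‖f‖ * ‖g‖ := fun B f g =>
    abs_le_of_diag_le ((ContinuousLinearMap.coeLM ℝ).comp (b B).toLinearMap) (hs B) (h0 B) (h2 B)
      f g
  have hnorm : ∀ f g, ‖D0 f g‖ ≤ 4 * ‖f‖ * ‖g‖ := by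
    intro f g
    -- Splitting by sign writes the `L¹` norm as two values of the forms `b B`, each at most `2 ‖f‖
    -- ‖g‖` in absolute value; hence the constant `4`.
    have hm : MeasurableSet {x | 0 ≤ D0 f g x} :=
      measurableSet_le measurable_const (Lp.stronglyMeasurable _).measurable
    have hi : Integrable (fun x => ‖D0 f g x‖) ν := (L1.integrable_coeFn _).norm
    rw [L1.norm_eq_integral_norm, ← integral_add_compl hm hi]
    have e1 : ∫ x in {x | 0 ≤ D0 f g x}, ‖D0 f g x‖ ∂ν = b {x | 0 ≤ D0 f g x} f g := by
      rw [← hD0int _ _ _ hm]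
      exact setIntegral_congr_fun hm fun x hx => Real.norm_of_nonneg hx
    have e2 : ∫ x in {x | 0 ≤ D0 f g x}ᶜ, ‖D0 f g x‖ ∂ν = -b {x | 0 ≤ D0 f g x}ᶜ f g := by
      rw [← hD0int _ _ _ hm.compl, ← integral_neg]
      refine setIntegral_congr_fun hm.compl fun x hx => Real.norm_of_nonpos ?_
      exact (not_le.1 (show ¬ 0 ≤ D0 f g x from hx)).le
    rw [e1, e2]
    have e3 := hbabs {x | 0 ≤ D0 f g x} f g
    have e4 := hbabs {x | 0 ≤ D0 f g x}ᶜ f g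
    linarith [le_abs_self (b {x | 0 ≤ D0 f g x} f g), neg_le_abs (b {x | 0 ≤ D0 f g x}ᶜ f g)]
  let D : E.Dom →L[ℝ] E.Dom →L[ℝ] Lp ℝ 1 ν :=
    (LinearMap.mk₂ ℝ D0 hadd hsmul (fun f g h => by rw [hsymm, hadd, hsymm g f, hsymm h f])
      (fun c f g => by rw [hsymm, hsmul, hsymm g f])).mkContinuous₂ 4 hnorm
  have hDD : ∀ f g, D f g = D0 f g := fun f g => rfl
  refine ⟨D, fun f g => hD0 f g, fun f g => hsymm f g, fun f => ?_, fun f B hB => ?_⟩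
  · refine ae_nonneg_of_forall_setIntegral_nonneg (L1.integrable_coeFn _) fun B hB _ => ?_
    rw [hDD, hD0int _ _ _ hB]
    exact h0 B f
  · rw [hDD, hD0int _ _ _ hB, hb f B hB]

end Density

end SymmetricForm

/-! ### Rank of positive semidefinite matrices and determinants of matrix pencils -/

section LinearAlgebra

open scoped MatrixOrder Matrix in
/-- A positive semidefinite matrix of rank at least `r` has an invertible principal block of
size `r`. -/
theorem exists_submatrix_det_ne_zero {N r : ℕ} {M : Matrix (Fin N) (Fin N) ℝ}
    (hM : M.PosSemidef) (hr : r ≤ M.rank) :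
    ∃ e : Fin r → Fin N, (M.submatrix e e).det ≠ 0 := by
  -- With `M = Bᴴ B`, principal blocks of `M` are Gram matrices of columns of `B`, invertible when
  -- the columns are independent.
  obtain ⟨B, hB⟩ := CStarAlgebra.nonneg_iff_eq_star_mul_self.mp hM.nonneg
  rw [Matrix.star_eq_conjTranspose] at hB
  rw [hB, Matrix.rank_conjTranspose_mul_self, Matrix.rank_eq_finrank_span_cols] at hr
  obtain ⟨f, hf, -, hli⟩ := Submodule.exists_fun_fin_finrank_span_eq ℝ (Set.range B.col)
  choose e0 he0 using hf
  refine ⟨fun i => e0 (Fin.castLE hr i), ?_⟩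
  set e : Fin r → Fin N := fun i => e0 (Fin.castLE hr i)
  have hcol : LinearIndependent ℝ (B.submatrix id e).col := by
    have h1 := hli.comp (Fin.castLE hr) (Fin.castLE_injective hr)
    have h2 : (B.submatrix id e).col = f ∘ Fin.castLE hr := by
      funext i
      exact he0 (Fin.castLE hr i)
    rwa [h2]
  have hpd := Matrix.PosDef.conjTranspose_mul_self (B.submatrix id e)
    (Matrix.mulVec_injective_iff.2 hcol)
  have h3 : M.submatrix e e = (B.submatrix id e)ᴴ * B.submatrix id e := by
    rw [hB]
    rfl
  rw [h3]
  exact hpd.det_pos.ne'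

open Polynomial in
theorem finite_det_quadratic_eq_zero_of_left {r : ℕ} {A : Matrix (Fin r) (Fin r) ℝ}
    (B C : Matrix (Fin r) (Fin r) ℝ) (hA : A.det ≠ 0) :
    {s : ℝ | (A + s • B + s ^ 2 • C).det = 0}.Finite := by
  let P : ℝ[X] := (A.map Polynomial.C + (X : ℝ[X]) • B.map Polynomial.C
    + (X ^ 2 : ℝ[X]) • C.map Polynomial.C).det
  have heval : ∀ s, P.eval s = (A + s • B + s ^ 2 • C).det := by
    intro s
    have := (Polynomial.evalRingHom s).map_det (A.map Polynomial.C + (X : ℝ[X]) • B.map Polynomial.C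
      + (X ^ 2 : ℝ[X]) • C.map Polynomial.C)
    rw [Polynomial.coe_evalRingHom] at this
    refine this.trans (congrArg Matrix.det ?_)
    ext i j
    simp
    ring
  have hP : P ≠ 0 := by
    intro h
    have := heval 0
    rw [h] at this
    simp at this
    exact hA this.symm
  refine (P.rootSet_finite ℝ).subset fun s hs => ?_
  rw [Polynomial.mem_rootSet]
  refine ⟨hP, ?_⟩
  rw [Polynomial.coe_aeval_eq_eval, heval]
  exact hs

/-- The determinant is a polynomial in `s`, nonzero at `0` if `det A ≠ 0`. If `det C ≠ 0`, the
substitution `s ↦ s⁻¹` exchanges `A` and `C`. -/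
theorem finite_det_quadratic_eq_zero {r : ℕ} {A C : Matrix (Fin r) (Fin r) ℝ}
    (B : Matrix (Fin r) (Fin r) ℝ) (h : A.det ≠ 0 ∨ C.det ≠ 0) :
    {s : ℝ | (A + s • B + s ^ 2 • C).det = 0}.Finite := by
  rcases h with h | h
  · exact finite_det_quadratic_eq_zero_of_left B C h
  · have h1 := finite_det_quadratic_eq_zero_of_left B A h
    refine ((h1.image (fun u => u⁻¹)).union (Set.finite_singleton 0)).subset fun s hs => ?_
    by_cases h0 : s = 0
    · exact Or.inr h0
    · refine Or.inl ⟨s⁻¹, ?_, inv_inv s⟩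
      have h2 : C + s⁻¹ • B + s⁻¹ ^ 2 • A = (s⁻¹ ^ 2) • (A + s • B + s ^ 2 • C) := by
        ext i j
        simp only [Matrix.add_apply, Matrix.smul_apply, smul_eq_mul]
        field_simp
        ring
      show (C + s⁻¹ • B + s⁻¹ ^ 2 • A).det = 0
      rw [h2, Matrix.det_smul, show (A + s • B + s ^ 2 • C).det = 0 from hs, mul_zero]

end LinearAlgebra

/-! ### Gram matrices of densities and generic perturbations -/

section Gram

variable {X : Type*} [MeasurableSpace X] {ν : Measure X} {V : Type*} [NormedAddCommGroup V]
  [NormedSpace ℝ V]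

/-- The Gram matrix of `f` at `x`, for a form `D` with values in functions on `X`. -/
def gram (D : V →L[ℝ] V →L[ℝ] Lp ℝ 1 ν) {N : ℕ} (f : Fin N → V) (x : X) :
    Matrix (Fin N) (Fin N) ℝ := Matrix.of fun i j => D (f i) (f j) x

variable (D : V →L[ℝ] V →L[ℝ] Lp ℝ 1 ν)

theorem measurable_gram {N : ℕ} (f : Fin N → V) (i j : Fin N) :
    Measurable fun x => gram D f x i j := (Lp.stronglyMeasurable _).measurable

theorem measurable_det {Y : Type*} [MeasurableSpace Y] {N : ℕ}
    {M : Y → Matrix (Fin N) (Fin N) ℝ} (h : ∀ i j, Measurable fun y => M y i j) :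
    Measurable fun y => (M y).det := by
  simp only [Matrix.det_apply']
  exact Finset.measurable_sum _ fun σ _ => measurable_const.mul
    (Finset.measurable_prod _ fun i _ => h _ _)

theorem measurableSet_gram_det_eq_zero {N : ℕ} (f : Fin N → V) :
    MeasurableSet {x | (gram D f x).det = 0} :=
  measurable_det (measurable_gram D f) (measurableSet_singleton 0)

/-- Each coefficient vector has its own null set, so only countably many can be tested: rational
vectors are used, and continuity of the quadratic form in the coefficients does the rest. -/
theorem gram_posSemidef (hs : ∀ f g, D f g = D g f) (h0 : ∀ f, 0 ≤ᵐ[ν] D f f) {N : ℕ}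
    (f : Fin N → V) : ∀ᵐ x ∂ν, (gram D f x).PosSemidef := by
  have h1 : ∀ᵐ x ∂ν, ∀ c : Fin N → ℚ,
      0 ≤ ∑ i, ∑ j, (c i : ℝ) * ((c j : ℝ) * gram D f x i j) := by
    rw [ae_all_iff]
    intro c
    have e : D (∑ i, (c i : ℝ) • f i) (∑ j, (c j : ℝ) • f j)
        = ∑ i, ∑ j, ((c i : ℝ) * (c j : ℝ)) • D (f i) (f j) := by
      simp only [map_sum, map_smul, sum_apply, smul_apply, Finset.smul_sum, smul_smul]
      exact Finset.sum_congr rfl fun i _ => Finset.sum_congr rfl fun j _ => by rw [hs]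
    have e1 : ∀ᵐ x ∂ν, ∀ i, (∑ j, ((c i : ℝ) * (c j : ℝ)) • D (f i) (f j) : Lp ℝ 1 ν) x
        = ∑ j, (((c i : ℝ) * (c j : ℝ)) • D (f i) (f j) : Lp ℝ 1 ν) x := by
      rw [ae_all_iff]
      exact fun i => Lp.coeFn_fun_finsetSum _ _
    have e2 : ∀ᵐ x ∂ν, ∀ i j, (((c i : ℝ) * (c j : ℝ)) • D (f i) (f j) : Lp ℝ 1 ν) x
        = ((c i : ℝ) * (c j : ℝ)) * D (f i) (f j) x := by
      rw [ae_all_iff]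
      intro i
      rw [ae_all_iff]
      exact fun j => Lp.coeFn_smul _ _
    filter_upwards [h0 (∑ i, (c i : ℝ) • f i), e1, e2, Lp.coeFn_fun_finsetSum Finset.univ
      fun i => ∑ j, ((c i : ℝ) * (c j : ℝ)) • D (f i) (f j)] with x h e1 e2 e3
    rw [e, e3] at h
    simp only [e1, e2, Pi.zero_apply, mul_assoc] at h
    exact h
  filter_upwards [h1] with x hx
  refine Matrix.PosSemidef.of_dotProduct_mulVec_nonneg ?_ fun y => ?_
  · ext i j
    simp only [Matrix.conjTranspose_apply, star_trivial, gram, Matrix.of_apply]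
    rw [hs]
  · have hcont : Continuous fun y : Fin N → ℝ => ∑ i, ∑ j, y i * (y j * gram D f x i j) := by
      fun_prop
    have hd : DenseRange fun (c : Fin N → ℚ) (i : Fin N) => (c i : ℝ) :=
      DenseRange.piMap fun _ => Rat.denseRange_cast
    have h2 : 0 ≤ ∑ i, ∑ j, y i * (y j * gram D f x i j) := by
      refine hd.induction_on (p := fun y => 0 ≤ ∑ i, ∑ j, y i * (y j * gram D f x i j)) y ?_ hx
      exact isClosed_le continuous_const hcont
    refine h2.trans (le_of_eq ?_)
    simp only [dotProduct, Matrix.mulVec, star_trivial, Finset.mul_sum]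
    refine Finset.sum_congr rfl fun i _ => Finset.sum_congr rfl fun j _ => ?_
    ring

theorem gram_add_smul {N : ℕ} (g h : Fin N → V) (s : ℝ) :
    ∀ᵐ x ∂ν, gram D (g + s • h) x = gram D g x
      + s • (Matrix.of fun i j => D (g i) (h j) x + D (h i) (g j) x) + s ^ 2 • gram D h x := by
  have h1 : ∀ᵐ x ∂ν, ∀ i j, D ((g + s • h) i) ((g + s • h) j) x = D (g i) (g j) x
      + s * (D (g i) (h j) x + D (h i) (g j) x) + s ^ 2 * D (h i) (h j) x := by
    rw [ae_all_iff]
    intro i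
    rw [ae_all_iff]
    intro j
    have e : D ((g + s • h) i) ((g + s • h) j) = D (g i) (g j)
        + s • (D (g i) (h j) + D (h i) (g j)) + s ^ 2 • D (h i) (h j) := by
      simp only [Pi.add_apply, Pi.smul_apply, map_add, add_apply, map_smul, smul_apply, smul_add,
        smul_smul, ← sq]
      abel
    rw [e]
    filter_upwards [Lp.coeFn_add (D (g i) (g j) + s • (D (g i) (h j) + D (h i) (g j)))
      (s ^ 2 • D (h i) (h j)), Lp.coeFn_add (D (g i) (g j)) (s • (D (g i) (h j) + D (h i) (g j))),
      Lp.coeFn_smul s (D (g i) (h j) + D (h i) (g j)), Lp.coeFn_add (D (g i) (h j)) (D (h i) (g j)),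
      Lp.coeFn_smul (s ^ 2) (D (h i) (h j))] with x h1 h2 h3 h4 h5
    rw [h1, Pi.add_apply, h2, Pi.add_apply, h3, Pi.smul_apply, h4, Pi.add_apply, h5, Pi.smul_apply,
      smul_eq_mul, smul_eq_mul]
  filter_upwards [h1] with x hx
  ext i j
  exact hx i j

/-- A generic small perturbation of `g` by `h` is nondegenerate wherever `g` or `h` is. -/
theorem exists_small_perturbation [SFinite ν] {N : ℕ} (g h : Fin N → V) {ε : ℝ} (hε : 0 < ε) :
    ∃ s : ℝ, 0 < s ∧ s < ε ∧ ∀ᵐ x ∂ν, ((gram D g x).det ≠ 0 ∨ (gram D h x).det ≠ 0) →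
      (gram D (g + s • h) x).det ≠ 0 := by
  set B : X → Matrix (Fin N) (Fin N) ℝ :=
    fun x => Matrix.of fun i j => D (g i) (h j) x + D (h i) (g j) x with hB
  have hBm : ∀ i j, Measurable fun x => B x i j := fun i j =>
    (Lp.stronglyMeasurable _).measurable.add (Lp.stronglyMeasurable _).measurable
  set p : ℝ → X → Prop := fun s x => ((gram D g x).det ≠ 0 ∨ (gram D h x).det ≠ 0) →
      (gram D g x + s • B x + s ^ 2 • gram D h x).det ≠ 0 with hp
  have hm : MeasurableSet {y : ℝ × X | p y.1 y.2} := by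
    have h1 : MeasurableSet {y : ℝ × X | (gram D g y.2).det = 0} :=
      measurable_snd (measurableSet_gram_det_eq_zero D g)
    have h2 : MeasurableSet {y : ℝ × X | (gram D h y.2).det = 0} :=
      measurable_snd (measurableSet_gram_det_eq_zero D h)
    have h3 : MeasurableSet {y : ℝ × X |
        (gram D g y.2 + y.1 • B y.2 + y.1 ^ 2 • gram D h y.2).det = 0} := by
      refine measurable_det (fun i j => ?_) (measurableSet_singleton 0)
      exact (((measurable_gram D g i j).comp measurable_snd).add
        (measurable_fst.mul ((hBm i j).comp measurable_snd))).add
        ((measurable_fst.pow_const 2).mul ((measurable_gram D h i j).comp measurable_snd))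
    have : {y : ℝ × X | p y.1 y.2} = ({y : ℝ × X | (gram D g y.2).det = 0} ∩
        {y : ℝ × X | (gram D h y.2).det = 0}) ∪ {y : ℝ × X |
        (gram D g y.2 + y.1 • B y.2 + y.1 ^ 2 • gram D h y.2).det = 0}ᶜ := by
      ext y
      simp only [hp, Set.mem_ofPred_eq, Set.mem_union, Set.mem_inter_iff, Set.mem_compl_iff]
      tauto
    rw [this]
    exact (h1.inter h2).union h3.compl
  -- Fubini: for each `x` only finitely many `s` are bad, so for almost every `s` the bad `x` form a
  -- null set.
  have hae : ∀ᵐ s ∂(volume.restrict (Set.Ioo 0 ε)), ∀ᵐ x ∂ν, p s x := by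
    rw [Measure.ae_ae_comm hm]
    refine ae_of_all _ fun x => ?_
    by_cases hx : (gram D g x).det ≠ 0 ∨ (gram D h x).det ≠ 0
    · have hfin := finite_det_quadratic_eq_zero (B x) hx
      refine ae_restrict_of_ae ?_
      filter_upwards [hfin.countable.ae_notMem volume] with s hs _
      exact hs
    · exact ae_of_all _ fun s hs => absurd hs hx
  have hpos : (volume.restrict (Set.Ioo 0 ε)) ≠ 0 := by
    rw [Ne, Measure.restrict_eq_zero, Real.volume_Ioo, ENNReal.ofReal_eq_zero]
    linarith
  have : (ae (volume.restrict (Set.Ioo 0 ε))).NeBot := ae_neBot.2 hpos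
  obtain ⟨s, hs, hsε⟩ := (hae.and (ae_restrict_mem measurableSet_Ioo)).exists
  refine ⟨s, hsε.1, hsε.2, ?_⟩
  filter_upwards [hs, gram_add_smul D g h s] with x hx hgx h1
  rw [hgx]
  exact hx h1

end Gram

/-! ### Smallest degenerate sets and Baire category -/

section Genericity

variable {X : Type*} [MeasurableSpace X] {ν : Measure X} {V : Type*} [NormedAddCommGroup V]
  [NormedSpace ℝ V] (D : V →L[ℝ] V →L[ℝ] Lp ℝ 1 ν)

/-- Sequences that converge in measure have a common subsequence converging almost everywhere. -/
theorem exists_common_subseq_tendsto_ae {ι : Type*} (s : Finset ι) {F : ι → ℕ → X → ℝ}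
    {G : ι → X → ℝ} (h : ∀ i, TendstoInMeasure ν (F i) atTop (G i)) :
    ∃ ns : ℕ → ℕ, StrictMono ns ∧ ∀ i ∈ s, ∀ᵐ x ∂ν,
      Tendsto (fun k => F i (ns k) x) atTop (𝓝 (G i x)) := by
  classical
  induction s using Finset.induction_on with
  | empty => exact ⟨id, strictMono_id, by simp⟩
  | insert a s _ ih =>
    obtain ⟨ns, hns, hs⟩ := ih
    have h1 : TendstoInMeasure ν (fun k => F a (ns k)) atTop (G a) := fun ε hε =>
      (h a ε hε).comp hns.tendsto_atTop
    obtain ⟨ms, hms, ha⟩ := h1.exists_seq_tendsto_ae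
    refine ⟨ns ∘ ms, hns.comp hms, fun i hi => ?_⟩
    rcases Finset.mem_insert.1 hi with rfl | hi
    · exact ha
    · filter_upwards [hs i hi] with x hx
      exact hx.comp hms.tendsto_atTop

/-- Up to arbitrarily small sets, a suitable `h` is nondegenerate wherever some `h'` is. -/
theorem exists_degenerate_set [SFinite ν] (r : ℕ) {A : Set X} (hA : MeasurableSet A) :
    ∃ S ⊆ A, MeasurableSet S ∧ (∀ h : Fin r → V, ∀ᵐ x ∂ν, x ∈ S → (gram D h x).det = 0) ∧
      ∀ n : ℕ, ∃ h : Fin r → V,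
        ν.toFinite ((A ∩ {x | (gram D h x).det = 0}) \ S) ≤ ((n : ℝ≥0∞) + 1)⁻¹ := by
  -- A finite measure with the null sets of `ν`, so that measures of degenerate sets can be
  -- minimized and continuity from above holds.
  set μ := ν.toFinite with hμ
  set Z : (Fin r → V) → Set X := fun h => A ∩ {x | (gram D h x).det = 0} with hZ
  have hZm : ∀ h, MeasurableSet (Z h) := fun h => hA.inter (measurableSet_gram_det_eq_zero D h)
  set β : ℝ≥0∞ := ⨅ h, μ (Z h) with hβ
  have hβtop : β ≠ ∞ := ne_top_of_le_ne_top (measure_ne_top μ (Z 0)) (iInf_le _ 0)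
  have hex : ∀ n : ℕ, ∃ h, μ (Z h) < β + ((n : ℝ≥0∞) + 1)⁻¹ := fun n => by
    have : β < β + ((n : ℝ≥0∞) + 1)⁻¹ := ENNReal.lt_add_right hβtop (by simp)
    exact iInf_lt_iff.1 this
  choose h hh using hex
  -- By successive generic perturbations, a finite intersection of degenerate sets almost contains
  -- the degenerate set of a single tuple, so its measure is at least `β`.
  have hcomb : ∀ (n : ℕ) (h' : Fin r → V), ∃ H, Z H ≤ᵐ[μ] ((⋂ k < n, Z (h k)) ∩ Z h' : Set X) := by
    intro n h'
    induction n with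
    | zero => exact ⟨h', ae_of_all _ fun x hx => ⟨by simp, hx⟩⟩
    | succ n ih =>
      obtain ⟨H, hH⟩ := ih
      obtain ⟨s, -, -, hs⟩ := exists_small_perturbation D H (h n) one_pos
      refine ⟨H + s • h n, ?_⟩
      rw [hμ, ae_toFinite] at hH ⊢
      filter_upwards [hs, hH] with x hx1 hx2 hx3
      have h1 : x ∈ A := hx3.1
      have h2 : (gram D (H + s • h n) x).det = 0 := hx3.2
      have h3 : (gram D H x).det = 0 ∧ (gram D (h n) x).det = 0 := by
        by_contra hne
        exact hx1 (by tauto) h2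
      have h4 : x ∈ (⋂ k < n, Z (h k)) ∩ Z h' := hx2 ⟨h1, h3.1⟩
      refine ⟨Set.mem_iInter₂.2 fun k hk => ?_, h4.2⟩
      rcases Nat.lt_succ_iff_lt_or_eq.1 hk with hk | rfl
      · exact Set.mem_iInter₂.1 h4.1 k hk
      · exact ⟨h1, h3.2⟩
  set S : Set X := ⋂ n, Z (h n) with hS
  have hSm : MeasurableSet S := MeasurableSet.iInter fun n => hZm _
  have hSle : μ S ≤ β := by
    refine ENNReal.le_of_forall_pos_le_add fun ε hε _ => ?_
    obtain ⟨n, hn⟩ := ENNReal.exists_inv_nat_lt (a := (ε : ℝ≥0∞)) (by simpa using hε.ne')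
    calc μ S ≤ μ (Z (h n)) := measure_mono (Set.iInter_subset _ n)
      _ ≤ β + ((n : ℝ≥0∞) + 1)⁻¹ := (hh n).le
      _ ≤ β + ε := by
        gcongr
        refine le_trans ?_ hn.le
        exact ENNReal.inv_le_inv.2 le_self_add
  have hSge : ∀ h', β ≤ μ (S ∩ Z h') := by
    intro h'
    have hanti : Antitone fun n : ℕ => (⋂ k < n, Z (h k)) ∩ Z h' := by
      intro a b hab x hx
      refine ⟨?_, hx.2⟩
      have := hx.1
      simp only [Set.mem_iInter] at this ⊢
      exact fun k hk => this k (hk.trans_le hab)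
    have hlim := tendsto_measure_iInter_atTop (μ := μ) (s := fun n : ℕ => (⋂ k < n, Z (h k)) ∩ Z h')
      (fun n => ((MeasurableSet.iInter fun k => MeasurableSet.iInter fun _ => hZm _).inter
        (hZm _)).nullMeasurableSet) hanti ⟨0, measure_ne_top _ _⟩
    have hle : β ≤ μ (⋂ n : ℕ, (⋂ k < n, Z (h k)) ∩ Z h') := by
      refine ge_of_tendsto' hlim fun n => ?_
      obtain ⟨H, hH⟩ := hcomb n h'
      exact (iInf_le _ H).trans (measure_mono_ae hH)
    refine hle.trans (measure_mono fun x hx => ?_)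
    simp only [Set.mem_iInter, Set.mem_inter_iff] at hx
    exact ⟨Set.mem_iInter.2 fun k => (hx (k + 1)).1 k k.lt_succ_self, (hx 0).2⟩
  refine ⟨S, (Set.iInter_subset _ 0).trans Set.inter_subset_left, hSm, fun h' => ?_, fun n => ?_⟩
  -- Since `μ S ≤ β ≤ μ (S ∩ Z h')`, the tuple `h'` is degenerate almost everywhere on `S`.
  · have h0 : μ (S \ (S ∩ Z h')) = 0 := by
      rw [measure_sdiff Set.inter_subset_left (hSm.inter (hZm _)).nullMeasurableSet
        (measure_ne_top _ _), tsub_eq_zero_iff_le]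
      exact hSle.trans (hSge h')
    have h1 : ∀ᵐ x ∂μ, x ∉ S \ (S ∩ Z h') := measure_eq_zero_iff_ae_notMem.1 h0
    rw [hμ, ae_toFinite] at h1
    filter_upwards [h1] with x hx hxS
    by_contra hne
    exact hx ⟨hxS, fun hx2 => hne hx2.2.2⟩
  · refine ⟨h n, ?_⟩
    have h2 : S ⊆ Z (h n) := Set.iInter_subset _ n
    rw [measure_sdiff h2 hSm.nullMeasurableSet (measure_ne_top _ _), tsub_le_iff_left]
    refine (hh n).le.trans ?_
    gcongr
    exact (hSge 0).trans (measure_mono Set.inter_subset_left)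

/-- Being degenerate on a set of measure at least `c` is a closed condition. -/
theorem isClosed_setOf_le_measure_degenerate [SFinite ν] {r p : ℕ} (σ : Fin r → Fin p) {A : Set X}
    (hA : MeasurableSet A) (c : ℝ≥0∞) :
    IsClosed {g : Fin p → V | c ≤ ν.toFinite (A ∩ {x | (gram D (g ∘ σ) x).det = 0})} := by
  set μ := ν.toFinite with hμ
  refine IsSeqClosed.isClosed fun g g0 hg hlim => ?_
  have hmeas : ∀ ij : Fin r × Fin r, TendstoInMeasure ν
      (fun k x => gram D (g k ∘ σ) x ij.1 ij.2) atTop (fun x => gram D (g0 ∘ σ) x ij.1 ij.2) := by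
    intro ij
    refine tendstoInMeasure_of_tendsto_Lp (p := 1) (f := fun k => D (g k (σ ij.1)) (g k (σ ij.2)))
      (g := D (g0 (σ ij.1)) (g0 (σ ij.2))) ?_
    have hcont : Continuous fun g : Fin p → V => D (g (σ ij.1)) (g (σ ij.2)) := by fun_prop
    exact (hcont.tendsto g0).comp hlim
  obtain ⟨ns, -, hae⟩ := exists_common_subseq_tendsto_ae Finset.univ hmeas
  -- The upper limit of the degenerate sets has measure at least `c`; almost everywhere on it the
  -- determinants converge and vanish infinitely often, so the limit determinant is zero.
  set U : ℕ → Set X := fun n => ⋃ k ≥ n, A ∩ {x | (gram D (g (ns k) ∘ σ) x).det = 0} with hU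
  have hUm : ∀ n, MeasurableSet (U n) := fun n => MeasurableSet.iUnion fun k =>
    MeasurableSet.iUnion fun _ => hA.inter (measurableSet_gram_det_eq_zero D _)
  have hanti : Antitone U := fun a b hab x hx => by
    simp only [hU, Set.mem_iUnion] at hx ⊢
    obtain ⟨k, hk, hx⟩ := hx
    exact ⟨k, hab.trans hk, hx⟩
  have hlimU := tendsto_measure_iInter_atTop (μ := μ) (fun n => (hUm n).nullMeasurableSet) hanti
    ⟨0, measure_ne_top _ _⟩
  have hle : c ≤ μ (⋂ n, U n) := by
    refine ge_of_tendsto' hlimU fun n => (hg (ns n)).trans (measure_mono fun x hx => ?_)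
    simp only [hU, Set.mem_iUnion]
    exact ⟨n, le_rfl, hx⟩
  refine hle.trans (measure_mono_ae ?_)
  have hall : ∀ᵐ x ∂ν, ∀ ij : Fin r × Fin r, Tendsto (fun k => gram D (g (ns k) ∘ σ) x ij.1 ij.2)
      atTop (𝓝 (gram D (g0 ∘ σ) x ij.1 ij.2)) := by
    rw [ae_all_iff]
    exact fun ij => hae ij (Finset.mem_univ _)
  rw [hμ, ae_toFinite]
  filter_upwards [hall] with x hx hxU
  have hx0 : ∀ n, ∃ k ≥ n, x ∈ A ∧ (gram D (g (ns k) ∘ σ) x).det = 0 := fun n => by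
    have := Set.mem_iInter.1 hxU n
    simp only [hU, Set.mem_iUnion] at this
    obtain ⟨k, hk, h1⟩ := this
    exact ⟨k, hk, h1.1, h1.2⟩
  refine ⟨(hx0 0).choose_spec.2.1, ?_⟩
  by_contra hne
  have hdet : Tendsto (fun k => (gram D (g (ns k) ∘ σ) x).det) atTop
      (𝓝 (gram D (g0 ∘ σ) x).det) := by
    have hM : Tendsto (fun k => gram D (g (ns k) ∘ σ) x) atTop (𝓝 (gram D (g0 ∘ σ) x)) := by
      refine tendsto_pi_nhds.2 fun i => tendsto_pi_nhds.2 fun j => hx (i, j)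
    exact (Continuous.matrix_det continuous_id).continuousAt.tendsto.comp hM
  obtain ⟨n, hn⟩ := eventually_atTop.1 (hdet.eventually_ne hne)
  obtain ⟨k, hk, -, h0⟩ := hx0 n
  exact hn k hk h0

/-- If nondegenerate tuples exist up to small sets, then generic tuples are nondegenerate. -/
theorem residual_nondegenerate [SFinite ν] {r p : ℕ} {σ : Fin r → Fin p}
    (hσ : Function.Injective σ) {A : Set X} (hA : MeasurableSet A)
    (hex : ∀ n : ℕ, ∃ h : Fin r → V,
      ν.toFinite (A ∩ {x | (gram D h x).det = 0}) ≤ ((n : ℝ≥0∞) + 1)⁻¹) :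
    {g : Fin p → V | ∀ᵐ x ∂ν, x ∈ A → (gram D (g ∘ σ) x).det ≠ 0} ∈ residual (Fin p → V) := by
  set μ := ν.toFinite with hμ
  set W : ℕ → Set (Fin p → V) := fun n =>
    {g | ((n : ℝ≥0∞) + 1)⁻¹ ≤ μ (A ∩ {x | (gram D (g ∘ σ) x).det = 0})}ᶜ with hW
  have hres : ∀ n, W n ∈ residual (Fin p → V) := by
    intro n
    refine residual_of_dense_open
      (isClosed_setOf_le_measure_degenerate D σ hA _).isOpen_compl ?_
    rw [Metric.dense_iff]
    intro g0 ε hε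
    -- Index `n + 1` makes the final inequality strict. The tuple `h` is extended by zero off the
    -- range of `σ`, so only the selected components are perturbed.
    obtain ⟨h, hh⟩ := hex (n + 1)
    set h' : Fin p → V := Function.extend σ h 0 with hh'
    have hcomp : h' ∘ σ = h := funext fun i => hσ.extend_apply h 0 i
    obtain ⟨s, hs0, hsε, hs⟩ := exists_small_perturbation D (g0 ∘ σ) h
      (ε := ε / (‖h'‖ + 1)) (by positivity)
    refine ⟨g0 + s • h', ?_, ?_⟩
    · rw [Metric.mem_ball, dist_eq_norm, add_sub_cancel_left, norm_smul, Real.norm_of_nonneg hs0.le]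
      rw [lt_div_iff₀ (by positivity)] at hsε
      nlinarith [norm_nonneg h']
    · show ¬ ((n : ℝ≥0∞) + 1)⁻¹ ≤ μ (A ∩ {x | (gram D ((g0 + s • h') ∘ σ) x).det = 0})
      rw [not_le]
      have e : (g0 + s • h') ∘ σ = g0 ∘ σ + s • h := by rw [← hcomp]; rfl
      rw [e]
      refine lt_of_le_of_lt ((measure_mono_ae ?_).trans hh) ?_
      · rw [hμ, ae_toFinite]
        filter_upwards [hs] with x hx hx2
        refine ⟨hx2.1, ?_⟩
        by_contra hne
        exact hx (Or.inr hne) hx2.2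
      · rw [ENNReal.inv_lt_inv]
        push_cast
        exact ENNReal.lt_add_right (by finiteness) one_ne_zero
  refine mem_of_superset (countable_iInter_mem.2 hres) fun g hg => ?_
  have h0 : μ (A ∩ {x | (gram D (g ∘ σ) x).det = 0}) = 0 := by
    refine le_antisymm (le_of_forall_gt fun ε hε => ?_) zero_le
    obtain ⟨n, hn⟩ := ENNReal.exists_inv_nat_lt hε.ne'
    have := Set.mem_iInter.1 hg n
    have h1 : μ (A ∩ {x | (gram D (g ∘ σ) x).det = 0}) < ((n : ℝ≥0∞) + 1)⁻¹ := not_le.1 this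
    exact h1.trans_le ((ENNReal.inv_le_inv.2 le_self_add).trans hn.le)
  have h1 : ∀ᵐ x ∂μ, x ∉ A ∩ {x | (gram D (g ∘ σ) x).det = 0} :=
    measure_eq_zero_iff_ae_notMem.1 h0
  rw [hμ, ae_toFinite] at h1
  filter_upwards [h1] with x hx hxA hdet
  exact hx ⟨hxA, hdet⟩

end Genericity

/-! ### Consequences of minimality of the index and of the dominant measure -/

namespace SymmetricForm

section Index

variable {X : Type*} [TopologicalSpace X] [MeasurableSpace X] {m : Measure X}
  {E : SymmetricForm m} {ν : Measure X} {D : E.Dom →L[ℝ] E.Dom →L[ℝ] Lp ℝ 1 ν}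

theorem gramMatrix_ae_eq (hD : ∀ f g, D f g =ᵐ[ν] (E.mutualEnergyMeasure f g).rnDeriv ν) {N : ℕ}
    (f : Fin N → E.Dom) : ∀ᵐ x ∂ν, E.gramMatrix ν f x = gram D f x := by
  have h : ∀ᵐ x ∂ν, ∀ i j, D (f i) (f j) x = (E.mutualEnergyMeasure (f i) (f j)).rnDeriv ν x := by
    rw [ae_all_iff]
    intro i
    rw [ae_all_iff]
    exact fun j => hD _ _
  filter_upwards [h] with x hx
  ext i j
  exact (hx i j).symm

/-- Where all `r`-tuples are degenerate, the pointwise index is less than `r`. -/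
theorem IsPointwiseIndex.measure_degenerate_eq_zero {q : X → ℕ∞} (hq : E.IsPointwiseIndex ν q)
    (hD : ∀ f g, D f g =ᵐ[ν] (E.mutualEnergyMeasure f g).rnDeriv ν)
    (hs : ∀ f g, D f g = D g f) (h0 : ∀ f, 0 ≤ᵐ[ν] D f f) {r : ℕ} {S : Set X}
    (hS : MeasurableSet S)
    (hdeg : ∀ h : Fin r → E.Dom, ∀ᵐ x ∂ν, x ∈ S → (gram D h x).det = 0)
    (hr : ∀ᵐ x ∂ν, x ∈ S → (r : ℕ∞) ≤ q x) : ν S = 0 := by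
  classical
  have hrank : ∀ (N : ℕ) (f : Fin N → E.Dom), ∀ᵐ x ∂ν, x ∈ S → (E.gramMatrix ν f x).rank < r := by
    intro N f
    have h1 : ∀ᵐ x ∂ν, ∀ e : Fin r → Fin N, x ∈ S → (gram D (f ∘ e) x).det = 0 := by
      rw [ae_all_iff]
      exact fun e => hdeg (f ∘ e)
    filter_upwards [h1, gram_posSemidef D hs h0 f, gramMatrix_ae_eq hD f] with x h1 h2 h3 hx
    rw [h3]
    by_contra hge
    obtain ⟨e, he⟩ := exists_submatrix_det_ne_zero h2 (not_lt.1 hge)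
    exact he (h1 e hx)
  -- Lowering the index to `r - 1` on `S` still bounds all ranks, so minimality contradicts `r ≤ q`
  -- there.
  set q' : X → ℕ∞ := S.piecewise (fun _ => ((r - 1 : ℕ) : ℕ∞)) q with hq'
  have hmeas : AEMeasurable q' ν :=
    ⟨S.piecewise (fun _ => ((r - 1 : ℕ) : ℕ∞)) (hq.aemeasurable.mk q),
      measurable_const.piecewise hS hq.aemeasurable.measurable_mk, by
        filter_upwards [hq.aemeasurable.ae_eq_mk] with x hx
        by_cases hxS : x ∈ S <;> simp [hq', hxS, hx]⟩
  have hbound : E.BoundsRank ν q' := by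
    intro N f
    filter_upwards [hrank N f, hq.boundsRank N f] with x h1 h2
    by_cases hxS : x ∈ S
    · have := h1 hxS
      rw [hq', Set.piecewise_eq_of_mem _ _ _ hxS]
      exact_mod_cast Nat.le_sub_one_of_lt this
    · rwa [hq', Set.piecewise_eq_of_notMem _ _ _ hxS]
  rw [measure_eq_zero_iff_ae_notMem]
  -- The empty tuple covers `r = 0`, where `r - 1` truncates to `0`: on `S` its rank would be less
  -- than `0`.
  filter_upwards [hq.minimal q' hmeas hbound, hr, hrank 0 Fin.elim0] with x h1 h2 h3 hxS
  rw [hq', Set.piecewise_eq_of_mem _ _ _ hxS] at h1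
  have h4 : (r : ℕ∞) ≤ ((r - 1 : ℕ) : ℕ∞) := (h2 hxS).trans h1
  have h5 : r ≤ r - 1 := by exact_mod_cast h4
  have h6 := h3 hxS
  omega

/-- Where the index is at least `r`, the smallest degenerate set is null, so nondegenerate
`r`-tuples exist up to small sets and the category argument applies. -/
theorem IsPointwiseIndex.residual_nondegenerate [SFinite ν] {q : X → ℕ∞}
    (hq : E.IsPointwiseIndex ν q)
    (hD : ∀ f g, D f g =ᵐ[ν] (E.mutualEnergyMeasure f g).rnDeriv ν)
    (hs : ∀ f g, D f g = D g f) (h0 : ∀ f, 0 ≤ᵐ[ν] D f f) {r p : ℕ} {σ : Fin r → Fin p}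
    (hσ : Function.Injective σ) {A : Set X} (hA : MeasurableSet A)
    (hr : ∀ᵐ x ∂ν, x ∈ A → (r : ℕ∞) ≤ q x) :
    {g : Fin p → E.Dom | ∀ᵐ x ∂ν, x ∈ A → (gram D (g ∘ σ) x).det ≠ 0}
      ∈ residual (Fin p → E.Dom) := by
  obtain ⟨S, hSA, hSm, hdeg, hex⟩ := exists_degenerate_set D r hA
  have hS0 : ν S = 0 := hq.measure_degenerate_eq_zero hD hs h0 hSm hdeg
    (hr.mono fun x hx hxS => hx (hSA hxS))
  have hS0' : ν.toFinite S = 0 := by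
    rw [measure_eq_zero_iff_ae_notMem, ae_toFinite]
    exact measure_eq_zero_iff_ae_notMem.1 hS0
  refine DirichletIndex.residual_nondegenerate D hσ hA fun n => ?_
  obtain ⟨h, hh⟩ := hex n
  exact ⟨h, by rwa [measure_sdiff_null hS0'] at hh⟩

/-- The pointwise index is almost everywhere positive. -/
theorem IsPointwiseIndex.one_le {q : X → ℕ∞} (hq : E.IsPointwiseIndex ν q)
    (hν : E.IsMinimalEnergyDominant ν)
    (hD : ∀ f g, D f g =ᵐ[ν] (E.mutualEnergyMeasure f g).rnDeriv ν)
    (hint : ∀ f B, MeasurableSet B → ∫ x in B, D f f x ∂ν = (E.energyMeasure f).real B) :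
    ∀ᵐ x ∂ν, 1 ≤ q x := by
  have := hν.sigmaFinite
  set S : Set X := {x | hq.aemeasurable.mk q x = 0} with hS
  have hSm : MeasurableSet S := hq.aemeasurable.measurable_mk (measurableSet_singleton 0)
  have hzero : ∀ f, E.energyMeasure f S = 0 := by
    intro f
    have h1 : ∀ᵐ x ∂ν, x ∈ S → D f f x = 0 := by
      filter_upwards [hq.boundsRank 1 fun _ => f, gramMatrix_ae_eq hD fun _ : Fin 1 => f,
        hq.aemeasurable.ae_eq_mk] with x h1 h2 h3 hx
      rw [h3, show hq.aemeasurable.mk q x = 0 from hx, h2] at h1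
      have h4 : (gram D (fun _ : Fin 1 => f) x).rank = 0 := by simpa using h1
      by_contra hne
      have h5 : IsUnit (gram D (fun _ : Fin 1 => f) x) := by
        rw [Matrix.isUnit_iff_isUnit_det, Matrix.det_fin_one]
        exact (show D f f x ≠ 0 from hne).isUnit
      rw [Matrix.rank_of_isUnit _ h5, Fintype.card_fin] at h4
      exact one_ne_zero h4
    have h2 := hint f S hSm
    rw [setIntegral_congr_ae (g := fun _ => (0 : ℝ)) hSm h1, integral_zero] at h2
    exact (measureReal_eq_zero_iff).1 h2.symm
  -- No energy measure charges the zero set `S` of the index, so `ν` restricted to its complement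
  -- still dominates, and minimality of `ν` makes `S` null.
  have hdom : E.IsEnergyDominant (ν.restrict Sᶜ) := by
    intro f
    refine Measure.AbsolutelyContinuous.mk fun B hB h0 => ?_
    rw [Measure.restrict_apply hB] at h0
    have h1 : E.energyMeasure f (B ∩ Sᶜ) = 0 := hν.dominant f h0
    refine measure_mono_null (fun x hx => ?_) (measure_union_null h1 (hzero f))
    by_cases hxS : x ∈ S
    · exact Or.inr hxS
    · exact Or.inl ⟨hx, hxS⟩
  have hS0 : ν S = 0 := by
    refine hν.minimal (ν.restrict Sᶜ) inferInstance hdom ?_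
    rw [Measure.restrict_apply hSm, Set.inter_compl_self, measure_empty]
  filter_upwards [measure_eq_zero_iff_ae_notMem.1 hS0, hq.aemeasurable.ae_eq_mk] with x h1 h2
  rw [h2]
  exact Order.one_le_iff_pos.2 (pos_iff_ne_zero.2 h1)

/-- An energy measure with positive density is a minimal energy-dominant measure. -/
theorem IsMinimalEnergyDominant.energyMeasure (hν : E.IsMinimalEnergyDominant ν)
    (h0 : ∀ f, 0 ≤ᵐ[ν] D f f)
    (hint : ∀ f B, MeasurableSet B → ∫ x in B, D f f x ∂ν = (E.energyMeasure f).real B)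
    {f : E.Dom} (hf : ∀ᵐ x ∂ν, D f f x ≠ 0) : E.IsMinimalEnergyDominant (E.energyMeasure f) := by
  have hac : ν ≪ E.energyMeasure f := by
    refine Measure.AbsolutelyContinuous.mk fun B hB hB0 => ?_
    have h1 : ∫ x in B, D f f x ∂ν = 0 := by
      rw [hint f B hB, measureReal_def, hB0, ENNReal.toReal_zero]
    rw [setIntegral_eq_zero_iff_of_nonneg_ae (ae_restrict_of_ae (h0 f))
      (L1.integrable_coeFn _).integrableOn] at h1
    have h2 : ∀ᵐ x ∂(ν.restrict B), False := by
      filter_upwards [h1, ae_restrict_of_ae hf] with x h1 h2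
      exact h2 h1
    rw [eventually_false_iff_eq_bot, ae_eq_bot, Measure.restrict_eq_zero] at h2
    exact h2
  exact ⟨inferInstance, fun g => (hν.dominant g).trans hac,
    fun ν' hν' hdom => (hν.dominant f).trans (hν.minimal ν' hν' hdom)⟩

end Index

end SymmetricForm

end DirichletIndex

end

/-! ### Density of both sets of coordinates -/

theorem mainTheorem1 {X : Type*} [TopologicalSpace X] [LocallyCompactSpace X]
    [TopologicalSpace.SeparableSpace X] [TopologicalSpace.MetrizableSpace X]
    [MeasurableSpace X] [BorelSpace X]
    (m : Measure X) [IsFiniteMeasureOnCompacts m] [m.IsOpenPosMeasure]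
    (E : DirichletIndex.SymmetricForm m)
    (hE : E.IsDirichletForm) (hreg : E.IsRegular) (hloc : E.IsStrongLocal)
    (ν : Measure X) (hν : E.IsMinimalEnergyDominant ν)
    (q : X → ℕ∞) (hq : E.IsPointwiseIndex ν q)
    (p : ℕ) (hp : essSup q ν = (p : ℕ∞)) (hp_pos : 0 < p) :
    Dense (E.coordSet ν q p) ∧ Dense (E.strongCoordSet ν q p) := by
  have : SecondCountableTopology X := by
    let _ := TopologicalSpace.metrizableSpaceMetric X
    exact UniformSpace.secondCountable_of_separable X
  have : IsLocallyFiniteMeasure m := isLocallyFiniteMeasure_of_isFiniteMeasureOnCompacts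
  have := hν.sigmaFinite
  have := hE.closed
  obtain ⟨D, hD, hs, h0, hint⟩ :=
    DirichletIndex.SymmetricForm.exists_density hE hreg hν.dominant
  have hcoord : E.coordSet ν q p ∈ residual (Fin p → E.Dom) := by
    -- One residual set for each value `r = 0, …, p` of the index. The level sets are taken for a
    -- measurable version of `q`.
    have h1 : ∀ r : Fin (p + 1), {g : Fin p → E.Dom | ∀ᵐ x ∂ν,
        x ∈ {x | hq.aemeasurable.mk q x = (r : ℕ)} →
          (DirichletIndex.gram D (g ∘ Fin.castLE (Nat.lt_succ_iff.1 r.2)) x).det ≠ 0}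
          ∈ residual (Fin p → E.Dom) := fun r =>
      hq.residual_nondegenerate hD hs h0 (Fin.castLE_injective _)
        (hq.aemeasurable.measurable_mk (measurableSet_singleton _)) (by
          filter_upwards [hq.aemeasurable.ae_eq_mk] with x hx hxr
          rw [hx, show hq.aemeasurable.mk q x = (r : ℕ) from hxr])
    filter_upwards [countable_iInter_mem.2 h1] with g hg
    have h2 : ∀ᵐ x ∂ν, ∀ r : Fin (p + 1), x ∈ {x | hq.aemeasurable.mk q x = (r : ℕ)} →
        (DirichletIndex.gram D (g ∘ Fin.castLE (Nat.lt_succ_iff.1 r.2)) x).det ≠ 0 := by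
      rw [ae_all_iff]
      exact fun r => Set.mem_iInter.1 hg r
    have h3 : ∀ᵐ x ∂ν, ∀ r : Fin (p + 1),
        E.gramMatrix ν (g ∘ Fin.castLE (Nat.lt_succ_iff.1 r.2)) x
          = DirichletIndex.gram D (g ∘ Fin.castLE (Nat.lt_succ_iff.1 r.2)) x := by
      rw [ae_all_iff]
      exact fun r => DirichletIndex.SymmetricForm.gramMatrix_ae_eq hD _
    filter_upwards [h2, h3, hq.aemeasurable.ae_eq_mk] with x h2 h3 h4 r hqr hr
    have h5 := h3 ⟨r, Nat.lt_succ_iff.2 hr⟩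
    have h6 := h2 ⟨r, Nat.lt_succ_iff.2 hr⟩ (h4.symm.trans hqr)
    rw [← h5] at h6
    exact (Matrix.isUnit_iff_isUnit_det _).2 h6.isUnit
  -- The case `r = 1`, with `σ` selecting the component `i`: the `1 × 1` determinant is the density
  -- of `μ_⟨g_i⟩`.
  have hpos : ∀ i : Fin p, {g : Fin p → E.Dom | ∀ᵐ x ∂ν, x ∈ Set.univ →
      (DirichletIndex.gram D (g ∘ fun _ : Fin 1 => i) x).det ≠ 0} ∈ residual (Fin p → E.Dom) :=
    fun i => hq.residual_nondegenerate hD hs h0 (Function.injective_of_subsingleton _)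
      MeasurableSet.univ ((hq.one_le hν hD hint).mono fun x hx _ => by simpa using hx)
  refine ⟨dense_of_mem_residual hcoord, dense_of_mem_residual ?_⟩
  filter_upwards [hcoord, countable_iInter_mem.2 hpos] with g hg1 hg2
  refine ⟨hg1, fun i => hν.energyMeasure h0 hint ?_⟩
  filter_upwards [Set.mem_iInter.1 hg2 i] with x hx
  simpa [DirichletIndex.gram] using hx (Set.mem_univ x)
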